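/- Let $g\ge 0$ and $n>0$ be integers with $2-2g-n<0$. Let $S$ be a closed connected oriented surface of genus $g$, that is, $S$ is homeomorphic to the sphere if $g=0$ and to the $4g$-gon with its sides identified along $\prod_{i=1}^g a_ib_ia_i^{-1}b_i^{-1}$ if $g\ge 1$. Let $P\subset S$ be any set of $n$ points. Then the punctured surface $\Sigma_{g,n}=S\setminus P$ admits a bipartite ideal triangulation. Here an ideal triangulation of $S\setminus P$ is a decomposition of $S\setminus P$ into finitely many faces, each of which is homeomorphic to a triangle with its vertices removed, embedded so that the parametrization extends continuously to the closed triangle and sends the vertices to points of $P$; the interior of a face meets no other face, and any two edges coincide or are disjoint. It is bipartite if its faces can be partitioned into two classes $F_1$ and $F_2$ such that, whenever two faces share an edge, one belongs to $F_1$ and the other to $F_2$. -/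

import Mathlib

namespace PuncturedSurface

/-! ### Closed oriented surfaces and their genus -/

/-- The `j`-th vertex of the regular `4g`-gon inscribed in the unit circle (indices modulo `4g`). -/
noncomputable def polygonVertex (g j : ℕ) : ℂ :=
  Complex.exp (2 * (Real.pi : ℂ) * Complex.I * ((j : ℂ) / (4 * (g : ℂ))))

/-- The closed regular `4g`-gon. -/
def polygon (g : ℕ) : Set ℂ :=
  convexHull ℝ (Set.range (polygonVertex g))

/-- The side identifications of the `4g`-gon whose boundary reads
`a₁ b₁ a₁⁻¹ b₁⁻¹ ⋯ a_g b_g a_g⁻¹ b_g⁻¹`. -/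
inductive SideIdentification (g : ℕ) : polygon g → polygon g → Prop
  | a (k : ℕ) (hk : k < g) (t : ℝ) (ht : t ∈ Set.Icc (0 : ℝ) 1) (x y : polygon g)
      (hx : (x : ℂ) = AffineMap.lineMap (polygonVertex g (4 * k)) (polygonVertex g (4 * k + 1)) t)
      (hy : (y : ℂ) =
        AffineMap.lineMap (polygonVertex g (4 * k + 3)) (polygonVertex g (4 * k + 2)) t) :
      SideIdentification g x y
  | b (k : ℕ) (hk : k < g) (t : ℝ) (ht : t ∈ Set.Icc (0 : ℝ) 1) (x y : polygon g)
      (hx : (x : ℂ) =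
        AffineMap.lineMap (polygonVertex g (4 * k + 1)) (polygonVertex g (4 * k + 2)) t)
      (hy : (y : ℂ) =
        AffineMap.lineMap (polygonVertex g (4 * k + 4)) (polygonVertex g (4 * k + 3)) t) :
      SideIdentification g x y

/-- The quotient (with the quotient topology) of the regular `4g`-gon by the identifications
`∏ [aᵢ, bᵢ]` of its sides; for `g ≥ 1` the standard closed oriented surface of genus `g`. -/
abbrev PolygonSurface (g : ℕ) : Type :=
  Quot (SideIdentification g)

/-- `S` is a closed oriented surface of genus `g`: a sphere for `g = 0`, and for `g ≥ 1` the
surface obtained from a `4g`-gon by identifying its sides along `∏ [aᵢ, bᵢ]`. -/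
def HasGenus (S : Type*) [TopologicalSpace S] : ℕ → Prop
  | 0 => Nonempty (S ≃ₜ Metric.sphere (0 : EuclideanSpace ℝ (Fin 3)) 1)
  | g + 1 => Nonempty (S ≃ₜ PolygonSurface (g + 1))

/-! ### Ideal triangulations -/

/-- The closed triangle, in barycentric coordinates. -/
abbrev Triangle : Type := stdSimplex ℝ (Fin 3)

/-- The three vertices of the triangle. -/
def vertices : Set Triangle := {x | ∃ i, x.1 i = 1}

/-- The open triangle. -/
def openTriangle : Set Triangle := {x | ∀ i, 0 < x.1 i}

/-- The open edge of the triangle opposite to the `i`-th vertex. -/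
def openEdge (i : Fin 3) : Set Triangle := {x | x.1 i = 0 ∧ ∀ j, j ≠ i → 0 < x.1 j}

/-- An ideal triangulation of the surface `Σ = S ∖ P`: a decomposition of `Σ` into finitely many
faces, each homeomorphic to a triangle whose vertices have been removed, the removed vertices
being punctures; distinct faces do not meet except along whole common edges.

A face is given by a parametrization by the closed triangle, with values in `S`; the face itself
is the image of the triangle without its vertices. (As the triangle is compact, the fields below
make `triangle ∖ vertices → S ∖ P` a closed embedding when `S` is Hausdorff.) -/
structure IdealTriangulation (S : Type*) [TopologicalSpace S] (P : Set S) where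
  /-- The faces. -/
  Face : Type
  /-- There are finitely many faces. -/
  finite_face : Finite Face
  /-- The parametrizations of the faces. -/
  param : Face → Triangle → S
  continuous_param : ∀ α, Continuous (param α)
  /-- Exactly the vertices of a triangle are sent to punctures. -/
  param_mem_iff : ∀ α x, param α x ∈ P ↔ x ∈ vertices
  /-- A face is homeomorphic to the triangle without its vertices. -/
  injOn_param : ∀ α, Set.InjOn (param α) verticesᶜ
  /-- The faces cover `Σ`. -/
  exists_param_eq : ∀ p, p ∉ P → ∃ α x, param α x = p
  /-- The interior of a face meets no other face. -/
  disjoint_interior : ∀ α β, α ≠ β →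
    Disjoint (param α '' openTriangle) (param β '' verticesᶜ)
  /-- Two edges are disjoint or coincide. -/
  edge_eq_or_disjoint : ∀ α β i j,
    param α '' openEdge i = param β '' openEdge j ∨
      Disjoint (param α '' openEdge i) (param β '' openEdge j)

namespace IdealTriangulation

/-- `β` is the neighbour of `α` across one of the edges of `α`. -/
def Neighbour {S : Type*} [TopologicalSpace S] {P : Set S} (T : IdealTriangulation S P)
    (α β : T.Face) : Prop :=
  ∃ i j : Fin 3, (α, i) ≠ (β, j) ∧ T.param α '' openEdge i = T.param β '' openEdge j

/-- The faces split into two classes such that the neighbours of a face of one class belong to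
the other class. -/
def IsBipartite {S : Type*} [TopologicalSpace S] {P : Set S} (T : IdealTriangulation S P) :
    Prop :=
  ∃ F₁ F₂ : Set T.Face, F₁ ∪ F₂ = Set.univ ∧ Disjoint F₁ F₂ ∧
    ∀ α β, T.Neighbour α β → (α ∈ F₁ → β ∈ F₂) ∧ (α ∈ F₂ → β ∈ F₁)

end IdealTriangulation

end PuncturedSurface

/-! The number of punctures and the genus are all that matter. A connected manifold of dimension at
least two is `n`-homogeneous: some self-homeomorphism carries any `n` points to any other `n` points
(`exists_homeomorph_image_eq`). It therefore suffices to find one set of `n` punctures with a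
two-coloured triangulation and to transport it.

Minimal examples come first. For `g = 0` the inequality forces `n ≥ 3`, and two triangles glued
along their boundary form a sphere with three vertices (`sphereTriangulation`). For `g ≥ 1` the
`4g`-gon has all its corners identified, so triangulating it without new vertices gives one puncture
(`PolygonFace.triangulation`). The triangles are coloured alternately, so that chords separate
colours (`IsPolygonFace.color_ne`). Gluing is harmless because the triangle at side `j` has colour
`j % 4 < 2` (`IsPolygonFace.color_side`), while side `j` is glued to side `j ± 2`.

Further punctures are inserted one at a time in the interior of a face
(`ColoredTriangulation.addPuncture`). Coning over an interior point would give it degree three,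
which cannot be two-coloured. Instead an arc parallel to the base cuts off a triangle, and the
remaining bigon is split into two triangles around a new vertex of degree two. The two outer parts
carry the old edges and the old colour, the middle part has the opposite colour, so neighbouring
faces are undisturbed (`part_mem_openEdge`, `part_eq_part_imp`). -/

namespace PuncturedSurface

/-! ### Two-coloured ideal triangulations -/

/-- A finite decomposition of `S` into 2-coloured ideal triangles with vertex set `P`, where faces
meet only along whole edges separating faces of different colours. -/
structure ColoredTriangulation (S : Type*) [TopologicalSpace S] (P : Set S) where
  /-- The faces. -/
  Face : Type
  finite_face : Finite Face
  nonempty_face : Nonempty Face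
  /-- The parametrizations of the faces. -/
  param : Face → Triangle → S
  /-- The colours of the faces. -/
  color : Face → Bool
  continuous_param : ∀ α, Continuous (param α)
  param_mem_iff : ∀ α x, param α x ∈ P ↔ x ∈ vertices
  exists_param_eq : ∀ p, p ∉ P → ∃ α x, param α x = p
  -- This one condition yields injectivity, disjoint interiors, the edge condition and the
  -- colouring. Since the colours must differ, no face is glued to itself.
  eq_or_edge : ∀ α β x y, x ∉ vertices → y ∉ vertices → param α x = param β y →
    (α = β ∧ x = y) ∨ (color α ≠ color β ∧ ∃ i j, x ∈ openEdge i ∧ y ∈ openEdge j ∧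
      param α '' openEdge i = param β '' openEdge j)

lemma openEdge_unique {x : Triangle} {i j : Fin 3} (hi : x ∈ openEdge i) (hj : x ∈ openEdge j) :
    i = j := by
  by_contra h
  exact (hj.2 i h).ne' hi.1

lemma notMem_vertices_of_openEdge {x : Triangle} {i : Fin 3} (hx : x ∈ openEdge i) :
    x ∉ vertices := by
  rintro ⟨j, hj⟩
  have hs := x.2.2
  rw [Fin.sum_univ_three] at hs
  obtain ⟨h0, h1⟩ := hx
  fin_cases i <;> fin_cases j <;> simp at * <;>
    [linarith [h1 1 (by decide), h1 2 (by decide)]; linarith [h1 1 (by decide), h1 2 (by decide)];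
     linarith [h1 1 (by decide), h1 2 (by decide)]; linarith [h1 0 (by decide), h1 2 (by decide)];
     linarith [h1 0 (by decide), h1 2 (by decide)]; linarith [h1 0 (by decide), h1 2 (by decide)];
     linarith [h1 0 (by decide), h1 1 (by decide)]; linarith [h1 0 (by decide), h1 1 (by decide)];
     linarith [h1 0 (by decide), h1 1 (by decide)]]

lemma notMem_vertices_of_openTriangle {x : Triangle} (hx : x ∈ openTriangle) :
    x ∉ vertices := by
  rintro ⟨j, hj⟩
  have hs := x.2.2
  rw [Fin.sum_univ_three] at hs
  have := hx 0; have := hx 1; have := hx 2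
  fin_cases j <;> simp at * <;> linarith

lemma notMem_openEdge_of_openTriangle {x : Triangle} (hx : x ∈ openTriangle) (i : Fin 3) :
    x ∉ openEdge i := fun h => (hx i).ne' h.1

/-- A point of the triangle which is not a vertex and has a vanishing coordinate lies on an open
edge. -/
lemma mem_openEdge_of_eq_zero {x : Triangle} (hx : x ∉ vertices) {i : Fin 3} (hi : x.1 i = 0) :
    x ∈ openEdge i := by
  have third : ∀ i j : Fin 3, ∃ k : Fin 3, k ≠ i ∧ k ≠ j := by decide
  refine ⟨hi, fun j hj => lt_of_le_of_ne (x.2.1 j) fun h => hx ?_⟩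
  have hs := x.2.2
  rw [Fin.sum_univ_three] at hs
  obtain ⟨k, hk⟩ := third i j
  refine ⟨k, ?_⟩
  fin_cases i <;> fin_cases j <;> fin_cases k <;> simp at * <;> linarith

namespace ColoredTriangulation

variable {S : Type*} [TopologicalSpace S] {P : Set S}

/-- The ideal triangulation underlying a coloured triangulation. -/
def toIdealTriangulation (T : ColoredTriangulation S P) : IdealTriangulation S P where
  Face := T.Face
  finite_face := T.finite_face
  param := T.param
  continuous_param := T.continuous_param
  param_mem_iff := T.param_mem_iff
  injOn_param α x hx y hy h := by
    rcases T.eq_or_edge α α x y hx hy h with h | h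
    · exact h.2
    · exact absurd rfl h.1
  exists_param_eq := T.exists_param_eq
  disjoint_interior α β hαβ := by
    rw [Set.disjoint_left]
    rintro _ ⟨x, hx, rfl⟩ ⟨y, hy, h⟩
    rcases T.eq_or_edge α β x y (notMem_vertices_of_openTriangle hx) hy h.symm with h | h
    · exact hαβ h.1
    · obtain ⟨-, i, j, hi, -⟩ := h
      exact notMem_openEdge_of_openTriangle hx i hi
  edge_eq_or_disjoint α β i j := by
    by_cases hd : Disjoint (T.param α '' openEdge i) (T.param β '' openEdge j)
    · exact Or.inr hd
    · left
      rw [Set.not_disjoint_iff] at hd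
      obtain ⟨_, ⟨x, hx, rfl⟩, ⟨y, hy, h⟩⟩ := hd
      rcases T.eq_or_edge α β x y (notMem_vertices_of_openEdge hx)
        (notMem_vertices_of_openEdge hy) h.symm with ⟨rfl, rfl⟩ | ⟨-, i', j', hi, hj, h⟩
      · rw [openEdge_unique hx hy]
      · rwa [openEdge_unique hx hi, openEdge_unique hy hj]

lemma exists_mem_openEdge (i : Fin 3) : ∃ x : Triangle, x ∈ openEdge i := by
  refine ⟨⟨fun j => if j = i then 0 else 1 / 2, fun j => ?_, ?_⟩, ?_, ?_⟩
  · simp only; split_ifs <;> norm_num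
  · rw [Fin.sum_univ_three]
    fin_cases i <;> simp <;> norm_num
  · simp
  · intro j hj
    simp [hj]

/-- At a point of a common edge, `eq_or_edge` leaves two possibilities: same face and same edge,
which the definition of neighbours excludes, or different colours. -/
lemma isBipartite (T : ColoredTriangulation S P) : T.toIdealTriangulation.IsBipartite := by
  refine ⟨{α | T.color α = true}, {α | T.color α = false}, ?_, ?_, ?_⟩
  · ext α
    simp
  · rw [Set.disjoint_left]
    intro α h1 h2
    simp_all
  · rintro α β ⟨i, j, hij, h⟩
    have hc : T.color α ≠ T.color β := by
      obtain ⟨x, hx⟩ := exists_mem_openEdge i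
      obtain ⟨y, hy, hxy⟩ : T.param α x ∈ T.param β '' openEdge j := h ▸ Set.mem_image_of_mem _ hx
      rcases T.eq_or_edge α β x y (notMem_vertices_of_openEdge hx)
        (notMem_vertices_of_openEdge hy) hxy.symm with ⟨rfl, rfl⟩ | ⟨h, -⟩
      · exact absurd (by rw [openEdge_unique hx hy]) hij
      · exact h
    simp only [Set.mem_ofPred_eq]
    change (T.color α = _ → T.color β = _) ∧ (T.color α = _ → T.color β = _)
    cases h1 : T.color α <;> cases h2 : T.color β <;> simp_all

/-- Transport of a coloured triangulation along a homeomorphism. -/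
def map {S' : Type*} [TopologicalSpace S'] (T : ColoredTriangulation S P) (e : S ≃ₜ S') :
    ColoredTriangulation S' (e '' P) where
  Face := T.Face
  finite_face := T.finite_face
  nonempty_face := T.nonempty_face
  param α x := e (T.param α x)
  color := T.color
  continuous_param α := e.continuous.comp (T.continuous_param α)
  param_mem_iff α x := by
    rw [e.injective.mem_set_image, T.param_mem_iff]
  exists_param_eq p hp := by
    obtain ⟨α, x, h⟩ := T.exists_param_eq (e.symm p) fun h => hp ⟨_, h, e.apply_symm_apply p⟩
    exact ⟨α, x, by rw [h, e.apply_symm_apply]⟩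
  eq_or_edge α β x y hx hy h := by
    rcases T.eq_or_edge α β x y hx hy (e.injective h) with h | ⟨h, i, j, hi, hj, hij⟩
    · exact Or.inl h
    · refine Or.inr ⟨h, i, j, hi, hj, ?_⟩
      have := congrArg (fun A => e '' A) hij
      simpa only [Set.image_image] using this

end ColoredTriangulation

/-! ### Cutting a triangle around a new interior vertex -/

/-- The height of the fibre of the triangle through `x` in the direction of the median through the
vertex `0`. -/
noncomputable def fibreHeight (x : Triangle) : ℝ := 1 - |x.1 1 - x.1 2|

lemma coord_bounds (x : Triangle) : 0 ≤ x.1 0 ∧ x.1 0 ≤ fibreHeight x ∧ 0 ≤ x.1 1 ∧ 0 ≤ x.1 2 ∧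
    x.1 0 + x.1 1 + x.1 2 = 1 := by
  have hs := x.2.2
  rw [Fin.sum_univ_three] at hs
  have h0 := x.2.1 0; have h1 := x.2.1 1; have h2 := x.2.1 2
  refine ⟨h0, ?_, h1, h2, hs⟩
  unfold fibreHeight
  rcases abs_cases (x.1 1 - x.1 2) with h | h <;> linarith

/-- The map of the triangle to itself which moves every point of height `x 0` to the height
`h` inside its fibre. -/
noncomputable def setHeight (x : Triangle) (h : ℝ) (h0 : 0 ≤ h) (h1 : h ≤ fibreHeight x) : Triangle :=
  ⟨![h, (1 - h + (x.1 1 - x.1 2)) / 2, (1 - h - (x.1 1 - x.1 2)) / 2], by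
    unfold fibreHeight at h1
    have := le_abs_self (x.1 1 - x.1 2)
    have := neg_abs_le (x.1 1 - x.1 2)
    constructor
    · intro i
      fin_cases i <;> simp <;> linarith
    · rw [Fin.sum_univ_three]
      simp
      ring⟩

/-- The heights of the three parts of a subdivided triangle, and of the triangle itself. -/
noncomputable def newHeight : Fin 4 → ℝ → ℝ → ℝ
  -- A fibre `[0, H]` is cut at `H / 3` and `2 * H / 3`. The middle part is traversed downwards, so
  -- its base matches the base of part 1 and its upper edges match those of part 3.
  | 0, _, h => h
  | 1, H, h => (2 * H + h) / 3
  | 2, H, h => (2 * H - h) / 3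
  | 3, _, h => h / 3

lemma newHeight_bounds (r : Fin 4) (x : Triangle) :
    0 ≤ newHeight r (fibreHeight x) (x.1 0) ∧
      newHeight r (fibreHeight x) (x.1 0) ≤ fibreHeight x := by
  obtain ⟨h0, h1, -⟩ := coord_bounds x
  fin_cases r <;> simp [newHeight] <;> constructor <;> linarith

/-- For `r = 1, 2, 3` the three parts into which a triangle is cut around a new vertex in its
interior; for `r = 0` the triangle itself. -/
noncomputable def part (r : Fin 4) (x : Triangle) : Triangle :=
  setHeight x (newHeight r (fibreHeight x) (x.1 0)) (newHeight_bounds r x).1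
    (newHeight_bounds r x).2

lemma continuous_part (r : Fin 4) : Continuous (part r) := by
  have hc : ∀ i : Fin 3, Continuous fun x : Triangle => x.1 i := fun i =>
    (continuous_apply i).comp continuous_subtype_val
  have hH : Continuous fibreHeight := continuous_const.sub ((hc 1).sub (hc 2)).abs
  have hn : Continuous fun x : Triangle => newHeight r (fibreHeight x) (x.1 0) := by
    fin_cases r
    · exact hc 0
    · exact ((continuous_const.mul hH).add (hc 0)).div_const 3
    · exact ((continuous_const.mul hH).sub (hc 0)).div_const 3
    · exact (hc 0).div_const 3
  refine Continuous.subtype_mk (continuous_pi fun i => ?_) _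
  fin_cases i
  · exact hn
  · exact ((continuous_const.sub hn).add ((hc 1).sub (hc 2))).div_const 2
  · exact ((continuous_const.sub hn).sub ((hc 1).sub (hc 2))).div_const 2

lemma part_diff (r : Fin 4) (x : Triangle) :
    (part r x).1 1 - (part r x).1 2 = x.1 1 - x.1 2 := by
  simp [part, setHeight]; ring

lemma fibreHeight_part (r : Fin 4) (x : Triangle) : fibreHeight (part r x) = fibreHeight x := by
  rw [fibreHeight, part_diff, fibreHeight]

lemma part_zero_coord (r : Fin 4) (x : Triangle) :
    (part r x).1 0 = newHeight r (fibreHeight x) (x.1 0) := by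
  simp [part, setHeight]

lemma triangle_ext {x y : Triangle} (h : x.1 0 = y.1 0)
    (hd : x.1 1 - x.1 2 = y.1 1 - y.1 2) : x = y := by
  obtain ⟨-, -, -, -, hx⟩ := coord_bounds x
  obtain ⟨-, -, -, -, hy⟩ := coord_bounds y
  refine Subtype.ext (funext fun i => ?_)
  fin_cases i <;> simp <;> linarith

lemma part_eq_part {r s : Fin 4} {x : Triangle}
    (h : newHeight r (fibreHeight x) (x.1 0) = newHeight s (fibreHeight x) (x.1 0)) :
    part r x = part s x :=
  triangle_ext (by rwa [part_zero_coord, part_zero_coord]) (by rw [part_diff, part_diff])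

lemma part_zero (x : Triangle) : part 0 x = x :=
  triangle_ext (part_zero_coord 0 x) (part_diff 0 x)

/-- Vertex 0 is the top of the central fibre; vertices 1 and 2 are the points where the fibre
shrinks to a point. -/
lemma mem_vertices_iff (x : Triangle) : x ∈ vertices ↔ x.1 0 = 1 ∨ fibreHeight x = 0 := by
  obtain ⟨h0, h, h1, h2, hs⟩ := coord_bounds x
  unfold fibreHeight at *
  constructor
  · rintro ⟨i, hi⟩
    rcases abs_cases (x.1 1 - x.1 2) with h' | h' <;> fin_cases i <;> simp at hi <;>
      first | (left; linarith) | (right; linarith)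
  · rintro (h | h)
    · exact ⟨0, h⟩
    · rcases abs_cases (x.1 1 - x.1 2) with h' | h'
      · exact ⟨1, by linarith⟩
      · exact ⟨2, by linarith⟩

lemma fibreHeight_pos {x : Triangle} (hx : x ∉ vertices) : 0 < fibreHeight x := by
  obtain ⟨h0, h, -⟩ := coord_bounds x
  rw [mem_vertices_iff] at hx
  push Not at hx
  exact lt_of_le_of_ne (h0.trans h) hx.2.symm

/-- The points of the upper two edges are those of maximal height in their fibre. -/
lemma eq_fibreHeight_iff {x : Triangle} (hx : x ∉ vertices) :
    x.1 0 = fibreHeight x ↔ ∃ i, i ≠ 0 ∧ x ∈ openEdge i := by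
  obtain ⟨h0, h, h1, h2, hs⟩ := coord_bounds x
  unfold fibreHeight at *
  constructor
  · intro h
    rcases abs_cases (x.1 1 - x.1 2) with h' | h'
    · exact ⟨2, by decide, mem_openEdge_of_eq_zero hx (by linarith)⟩
    · exact ⟨1, by decide, mem_openEdge_of_eq_zero hx (by linarith)⟩
  · rintro ⟨i, hi, hxi⟩
    have := hxi.1
    rcases abs_cases (x.1 1 - x.1 2) with h' | h' <;> fin_cases i <;> simp at hi this <;> linarith

lemma part_eq_self {r : Fin 4} {x : Triangle}
    (h : newHeight r (fibreHeight x) (x.1 0) = x.1 0) : part r x = x := by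
  conv_rhs => rw [← part_zero x]
  exact part_eq_part h

/-- The colour of a part, relative to the colour of the whole triangle. -/
def partColor : Fin 4 → Bool
  | 2 => true
  | _ => false

/-- The new vertex. -/
noncomputable def newVertex : Triangle := ⟨fun _ => 1 / 3, fun _ => by norm_num, by simp⟩

lemma newVertex_mem : newVertex ∈ openTriangle := fun i => by simp [newVertex]

/-- Vertices 1 and 2 are fixed by every part. Vertex 0 is fixed by parts 0 and 1, and goes to height
`1 / 3` on the central fibre, the new vertex, under parts 2 and 3. -/
lemma part_mem_iff (r : Fin 4) (x : Triangle) :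
    part r x ∈ vertices ∨ (r ≠ 0 ∧ part r x = newVertex) ↔ x ∈ vertices := by
  obtain ⟨h0, h, h1, h2, hs⟩ := coord_bounds x
  have hle : fibreHeight x ≤ 1 := by unfold fibreHeight; linarith [abs_nonneg (x.1 1 - x.1 2)]
  rw [mem_vertices_iff, fibreHeight_part, part_zero_coord, mem_vertices_iff]
  constructor
  · rintro ((h | h) | ⟨hr, h⟩)
    · left
      fin_cases r <;> simp [newHeight] at h <;> linarith
    · exact Or.inr h
    · have e1 := part_zero_coord r x
      have e2 := part_diff r x
      rw [h] at e1 e2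
      simp [newVertex] at e1 e2
      have e3 : fibreHeight x = 1 := by simp [fibreHeight, ← e2]
      rw [e3] at e1
      left
      fin_cases r <;> simp [newHeight] at e1 hr <;> linarith
  · rintro (h' | h')
    · have e3 : fibreHeight x = 1 := by linarith
      have e4 : x.1 1 - x.1 2 = 0 := by linarith
      rw [e3, h']
      have key : ∀ {r}, newHeight r 1 1 = 1 / 3 → part r x = newVertex := fun {r} hr => by
        refine triangle_ext ?_ ?_
        · rw [part_zero_coord, e3, h', hr]; rfl
        · rw [part_diff, e4]; simp [newVertex]
      fin_cases r
      · left; left; simp [newHeight]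
      · left; left; norm_num [newHeight]
      · right; exact ⟨by decide, key (by norm_num [newHeight])⟩
      · right; exact ⟨by decide, key (by norm_num [newHeight])⟩
    · exact Or.inl (Or.inr h')

lemma part_notMem {r : Fin 4} {x : Triangle} (hx : x ∉ vertices) : part r x ∉ vertices :=
  fun h => hx ((part_mem_iff r x).1 (Or.inl h))

/-- The three parts cover the triangle. -/
lemma exists_part_eq (y : Triangle) : ∃ r : Fin 4, r ≠ 0 ∧ ∃ x, part r x = y := by
  obtain ⟨h0, h1, -⟩ := coord_bounds y
  have key : ∀ (r : Fin 4) (h : ℝ) (h0 : 0 ≤ h) (h1 : h ≤ fibreHeight y),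
      newHeight r (fibreHeight y) h = y.1 0 → ∃ x, part r x = y := by
    intro r h h0 h1 hr
    have e1 : (setHeight y h h0 h1).1 1 - (setHeight y h h0 h1).1 2 = y.1 1 - y.1 2 := by
      simp [setHeight]; ring
    refine ⟨setHeight y h h0 h1, triangle_ext ?_ ?_⟩
    · rw [part_zero_coord, fibreHeight, e1, ← hr]
      rfl
    · rw [part_diff, e1]
  by_cases c1 : 2 * fibreHeight y ≤ 3 * y.1 0
  · exact ⟨1, by decide, key 1 (3 * y.1 0 - 2 * fibreHeight y) (by linarith) (by linarith)
      (by simp [newHeight])⟩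
  by_cases c2 : fibreHeight y ≤ 3 * y.1 0
  · exact ⟨2, by decide, key 2 (2 * fibreHeight y - 3 * y.1 0) (by linarith) (by linarith)
      (by simp [newHeight])⟩
  · exact ⟨3, by decide, key 3 (3 * y.1 0) (by linarith) (by linarith)
      (by simp [newHeight])⟩

/-- The parts meet the edges of the triangle along whole edges. -/
lemma part_mem_openEdge {r : Fin 4} {x : Triangle} (hx : x ∉ vertices) {i : Fin 3}
    (hi : part r x ∈ openEdge i) :
    partColor r = false ∧ x ∈ openEdge i ∧ ∀ y ∈ openEdge i, part r y = y := by
  obtain ⟨h0, h1, -⟩ := coord_bounds x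
  have hH := fibreHeight_pos hx
  by_cases hi0 : i = 0
  · subst hi0
    have h := hi.1
    rw [part_zero_coord] at h
    -- Height zero on a fibre of positive length excludes parts 1 and 2, which stay at height at
    -- least `H / 3`.
    have hr : r = 0 ∨ r = 3 := by
      fin_cases r <;> simp [newHeight] at h ⊢ <;> linarith
    rcases hr with rfl | rfl
    · exact ⟨rfl, by rwa [part_zero] at hi, fun y _ => part_zero y⟩
    · refine ⟨rfl, mem_openEdge_of_eq_zero hx (by simp [newHeight] at h; linarith), ?_⟩
      intro y hy
      exact part_eq_self (by simp [newHeight, hy.1])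
  · have h := (eq_fibreHeight_iff (part_notMem hx)).2 ⟨i, hi0, hi⟩
    rw [part_zero_coord, fibreHeight_part] at h
    have hr : r = 0 ∨ r = 1 := by
      fin_cases r <;> simp [newHeight] at h ⊢ <;> linarith
    rcases hr with rfl | rfl
    · exact ⟨rfl, by rwa [part_zero] at hi, fun y _ => part_zero y⟩
    · have e : part 1 x = x := part_eq_self (by simp [newHeight] at h ⊢; linarith)
      refine ⟨rfl, by rwa [e] at hi, ?_⟩
      intro y hy
      have := (eq_fibreHeight_iff (notMem_vertices_of_openEdge hy)).2 ⟨i, hi0, hy⟩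
      exact part_eq_self (by simp [newHeight]; linarith)

/-- The parts meet along whole edges. -/
lemma part_eq_part_imp {r s : Fin 4} (hr : r ≠ 0) (hs : s ≠ 0) {x y : Triangle}
    (hx : x ∉ vertices) (hy : y ∉ vertices) (h : part r x = part s y) :
    (r = s ∧ x = y) ∨ (partColor r ≠ partColor s ∧ ∃ i, x ∈ openEdge i ∧ y ∈ openEdge i ∧
      ∀ z ∈ openEdge i, part r z = part s z) := by
  have hd : x.1 1 - x.1 2 = y.1 1 - y.1 2 := by rw [← part_diff r x, h, part_diff]
  have hH : fibreHeight x = fibreHeight y := by rw [fibreHeight, hd, fibreHeight]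
  have h' := part_zero_coord r x
  rw [h, part_zero_coord, ← hH] at h'
  have hpos := fibreHeight_pos hx
  obtain ⟨x0, x1, -⟩ := coord_bounds x
  obtain ⟨y0, y1, -⟩ := coord_bounds y
  rw [← hH] at y1
  -- Parts 1 and 2 meet only at height `2 * H / 3`, the image of the base of both.
  have base : ∀ {r s : Fin 4}, x.1 0 = 0 → y.1 0 = 0 → (r = 1 ∧ s = 2) ∨ (r = 2 ∧ s = 1) →
      partColor r ≠ partColor s ∧ ∃ i, x ∈ openEdge i ∧ y ∈ openEdge i ∧
      ∀ z ∈ openEdge i, part r z = part s z := by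
    intro r s hx0 hy0 hrs
    have e : ∀ z ∈ openEdge 0, part 1 z = part 2 z := fun z hz =>
      part_eq_part (by simp [newHeight, hz.1])
    rcases hrs with ⟨rfl, rfl⟩ | ⟨rfl, rfl⟩
    · exact ⟨by decide, 0, mem_openEdge_of_eq_zero hx hx0, mem_openEdge_of_eq_zero hy hy0, e⟩
    · exact ⟨by decide, 0, mem_openEdge_of_eq_zero hx hx0, mem_openEdge_of_eq_zero hy hy0,
        fun z hz => (e z hz).symm⟩
  -- Parts 2 and 3 meet only at height `H / 3`, the image of the two upper edges of both.
  have top : ∀ {r s : Fin 4}, x.1 0 = fibreHeight x → y.1 0 = fibreHeight x →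
      (r = 2 ∧ s = 3) ∨ (r = 3 ∧ s = 2) →
      partColor r ≠ partColor s ∧ ∃ i, x ∈ openEdge i ∧ y ∈ openEdge i ∧
      ∀ z ∈ openEdge i, part r z = part s z := by
    intro r s hx0 hy0 hrs
    have hxy : x = y := triangle_ext (hx0.trans hy0.symm) hd
    subst hxy
    obtain ⟨i, hi0, hi⟩ := (eq_fibreHeight_iff hx).1 hx0
    have e : ∀ z ∈ openEdge i, part 2 z = part 3 z := fun z hz =>
      part_eq_part (by
        have := (eq_fibreHeight_iff (notMem_vertices_of_openEdge hz)).2 ⟨i, hi0, hz⟩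
        simp [newHeight]; linarith)
    rcases hrs with ⟨rfl, rfl⟩ | ⟨rfl, rfl⟩
    · exact ⟨by decide, i, hi, hi, e⟩
    · exact ⟨by decide, i, hi, hi, fun z hz => (e z hz).symm⟩
  have same : x.1 0 = y.1 0 → x = y := fun h => triangle_ext h hd
  fin_cases r <;> fin_cases s <;> simp [newHeight] at h' hr hs
  · exact Or.inl ⟨rfl, same (by linarith)⟩
  · exact Or.inr (base (by linarith) (by linarith) (by decide))
  · linarith
  · exact Or.inr (base (by linarith) (by linarith) (by decide))
  · exact Or.inl ⟨rfl, same (by linarith)⟩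
  · exact Or.inr (top (by linarith) (by linarith) (by decide))
  · linarith
  · exact Or.inr (top (by linarith) (by linarith) (by decide))
  · exact Or.inl ⟨rfl, same (by linarith)⟩

/-! ### Adding punctures one at a time -/

namespace ColoredTriangulation

variable {S : Type*} [TopologicalSpace S] {P : Set S}

/-- Adding a puncture in the interior of a face. -/
noncomputable def addPuncture (T : ColoredTriangulation S P) (α₀ : T.Face) :
    ColoredTriangulation S (insert (T.param α₀ newVertex) P) where
  -- Index 0 marks an untouched face; indices 1, 2, 3 are the parts of `α₀`.
  Face := {f : T.Face × Fin 4 // f.1 = α₀ ↔ f.2 ≠ 0}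
  finite_face := by
    have := T.finite_face
    infer_instance
  nonempty_face := ⟨⟨(α₀, 1), by simp⟩⟩
  param f x := T.param f.1.1 (part f.1.2 x)
  color f := xor (T.color f.1.1) (partColor f.1.2)
  continuous_param f := (T.continuous_param _).comp (continuous_part _)
  param_mem_iff := by
    rintro ⟨⟨α, r⟩, hr⟩ x
    simp only at hr ⊢
    rw [← part_mem_iff r x, Set.mem_insert_iff, T.param_mem_iff, or_comm]
    by_cases hv : part r x ∈ vertices
    · simp [hv]
    · simp only [hv, false_or]
      constructor
      · intro h
        rcases T.eq_or_edge _ _ _ _ hv (notMem_vertices_of_openTriangle newVertex_mem) h with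
          ⟨rfl, h'⟩ | ⟨-, i, j, -, hj, -⟩
        · exact ⟨hr.1 rfl, h'⟩
        · exact absurd hj (notMem_openEdge_of_openTriangle newVertex_mem j)
      · rintro ⟨h, h'⟩
        rw [h', hr.2 h]
  exists_param_eq p hp := by
    obtain ⟨α, y, rfl⟩ := T.exists_param_eq p fun h => hp (Or.inr h)
    by_cases hα : α = α₀
    · obtain ⟨r, hr, x, rfl⟩ := exists_part_eq y
      exact ⟨⟨(α, r), by simp [hα, hr]⟩, x, rfl⟩
    · exact ⟨⟨(α, 0), by simp [hα]⟩, y, by simp [part_zero]⟩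
  eq_or_edge := by
    rintro ⟨⟨α, r⟩, hr⟩ ⟨⟨β, s⟩, hs⟩ x y hx hy h
    simp only at hr hs h ⊢
    rcases T.eq_or_edge _ _ _ _ (part_notMem hx) (part_notMem hy) h with
      ⟨rfl, h'⟩ | ⟨hc, i, j, hi, hj, hij⟩
    · by_cases hα : α = α₀
      · rcases part_eq_part_imp (hr.1 hα) (hs.1 hα) hx hy h' with ⟨rfl, e⟩ | ⟨hc, i, hi, hj, hij⟩
        · exact Or.inl ⟨rfl, e⟩
        · refine Or.inr ⟨by simpa using hc, i, i, hi, hj, ?_⟩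
          exact Set.image_congr fun z hz => by rw [hij z hz]
      · have hr0 : r = 0 := by by_contra h; exact hα (hr.2 h)
        have hs0 : s = 0 := by by_contra h; exact hα (hs.2 h)
        subst hr0 hs0
        rw [part_zero, part_zero] at h'
        exact Or.inl ⟨rfl, h'⟩
    · obtain ⟨c1, hx', e1⟩ := part_mem_openEdge hx hi
      obtain ⟨c2, hy', e2⟩ := part_mem_openEdge hy hj
      refine Or.inr ⟨by simpa [c1, c2] using hc, i, j, hx', hy', ?_⟩
      rw [Set.image_congr fun z hz => by rw [e1 z hz], hij]
      exact Set.image_congr fun z hz => by rw [e2 z hz]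

/-- A coloured triangulation with `m` punctures can be refined to one with `n ≥ m` punctures. -/
lemma exists_card {m n : ℕ} (hmn : m ≤ n) (P : Finset S) (hP : P.card = m)
    (T : ColoredTriangulation S (P : Set S)) :
    ∃ Q : Finset S, Q.card = n ∧ Nonempty (ColoredTriangulation S (Q : Set S)) := by
  classical
  induction n, hmn using Nat.le_induction with
  | base => exact ⟨P, hP, ⟨T⟩⟩
  | succ n _ ih =>
    obtain ⟨Q, hQ, ⟨T⟩⟩ := ih
    obtain ⟨α⟩ := T.nonempty_face
    refine ⟨insert (T.param α newVertex) Q, ?_, ⟨?_⟩⟩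
    · rw [Finset.card_insert_of_notMem, hQ]
      have h := (T.param_mem_iff α newVertex).not.2
        (notMem_vertices_of_openTriangle newVertex_mem)
      exact_mod_cast h
    · rw [Finset.coe_insert]
      exact T.addPuncture α

end ColoredTriangulation

/-! ### The sphere with three punctures -/

/-- The smallest barycentric coordinate. -/
noncomputable def minCoord (x : Triangle) : ℝ := min (x.1 0) (min (x.1 1) (x.1 2))

lemma minCoord_le (x : Triangle) (i : Fin 3) : minCoord x ≤ x.1 i := by
  unfold minCoord
  fin_cases i <;> simp

lemma exists_eq_minCoord (x : Triangle) : ∃ i, x.1 i = minCoord x := by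
  unfold minCoord
  rcases min_choice (x.1 1) (x.1 2) with h | h <;> rw [h]
  · rcases min_choice (x.1 0) (x.1 1) with h | h <;> rw [h] <;> exact ⟨_, rfl⟩
  · rcases min_choice (x.1 0) (x.1 2) with h | h <;> rw [h] <;> exact ⟨_, rfl⟩

lemma minCoord_nonneg (x : Triangle) : 0 ≤ minCoord x := by
  obtain ⟨i, hi⟩ := exists_eq_minCoord x
  rw [← hi]; exact x.2.1 i

/-- The two faces as surfaces in `ℝ³`, up to normalization: `false` gives the positive octant and
`true` its complement. -/
noncomputable def coneMap (c : Bool) (x : Triangle) : EuclideanSpace ℝ (Fin 3) :=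
  WithLp.toLp 2 fun i => x.1 i - (if c then 2 * minCoord x else 0)

lemma coneMap_apply (c : Bool) (x : Triangle) (i : Fin 3) :
    coneMap c x i = x.1 i - (if c then 2 * minCoord x else 0) := rfl

lemma continuous_coneMap (c : Bool) : Continuous (coneMap c) := by
  have hc : ∀ i : Fin 3, Continuous fun x : Triangle => x.1 i := fun i =>
    (continuous_apply i).comp continuous_subtype_val
  refine (PiLp.continuous_toLp 2 _).comp (continuous_pi fun i => (hc i).sub ?_)
  cases c
  · exact continuous_const
  · exact continuous_const.mul ((hc 0).min ((hc 1).min (hc 2)))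

/-- The smallest coordinate of `coneMap c x` is `± minCoord x`. -/
lemma coneMap_sub (c : Bool) (x : Triangle) :
    (∃ i, coneMap c x i = if c then - minCoord x else minCoord x) ∧
      ∀ i, (if c then - minCoord x else minCoord x) ≤ coneMap c x i := by
  obtain ⟨i, hi⟩ := exists_eq_minCoord x
  refine ⟨⟨i, ?_⟩, fun j => ?_⟩
  · rw [coneMap_apply, hi]
    cases c <;> simp; ring
  · have := minCoord_le x j
    rw [coneMap_apply]
    cases c <;> simp <;> linarith

/-- The smallest coordinate is compatible with positive scaling and equals `minCoord` up to the sign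
given by the colour. Comparing both sides, different signs force both minima to vanish. The
barycentric coordinates are then proportional, and their sum 1 gives `r = 1`. -/
lemma coneMap_eq_smul {c d : Bool} {x y : Triangle} {r : ℝ} (hr : 0 < r)
    (h : coneMap c x = r • coneMap d y) :
    x = y ∧ (c ≠ d → minCoord x = 0) := by
  have hi : ∀ i, coneMap c x i = r * coneMap d y i := fun i => by rw [h]; rfl
  have hmin : (if c then - minCoord x else minCoord x) =
      r * (if d then - minCoord y else minCoord y) := by
    obtain ⟨⟨i, hxi⟩, hx⟩ := coneMap_sub c x
    obtain ⟨⟨j, hyj⟩, hy⟩ := coneMap_sub d y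
    refine le_antisymm ?_ ?_
    · rw [← hyj, ← hi]; exact hx j
    · rw [← hxi, hi]; exact mul_le_mul_of_nonneg_left (hy i) hr.le
  have hx0 := minCoord_nonneg x
  have hy0 := minCoord_nonneg y
  have hry := mul_nonneg hr.le hy0
  obtain ⟨-, -, -, -, hx⟩ := coord_bounds x
  obtain ⟨-, -, -, -, hy⟩ := coord_bounds y
  have h0 := hi 0
  have h1 := hi 1
  have h2 := hi 2
  simp only [coneMap_apply] at h0 h1 h2
  have hmm : minCoord x = r * minCoord y ∧ (c ≠ d → minCoord x = 0) := by
    cases c <;> cases d <;> simp at hmin ⊢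
    · exact hmin
    · constructor <;> linarith
    · constructor <;> linarith
    · linarith
  have hxy : ∀ i, x.1 i = r * y.1 i := by
    intro i
    have := hi i
    simp only [coneMap_apply] at this
    obtain ⟨hm1, hm2⟩ := hmm
    have hm2' : c ≠ d → r * minCoord y = 0 := fun h => by rw [← hm1, hm2 h]
    cases c <;> cases d <;> simp only [if_true, if_false, Bool.false_eq_true] at this
    · linarith
    · linarith [hm2' (by decide)]
    · linarith [hm2 (by decide)]
    · linarith
  have hr1 : r = 1 := by
    have := hxy 0; have := hxy 1; have := hxy 2
    have : r * (y.1 0 + y.1 1 + y.1 2) = 1 := by linarith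
    rwa [hy, mul_one] at this
  refine ⟨Subtype.ext (funext fun i => by rw [hxy i, hr1, one_mul]), hmm.2⟩

lemma coneMap_ne_zero (c : Bool) (x : Triangle) : coneMap c x ≠ 0 := by
  intro h
  have hi : ∀ i, coneMap c x i = 0 := fun i => by rw [h]; rfl
  have hx0 := minCoord_nonneg x
  obtain ⟨⟨i, hxi⟩, -⟩ := coneMap_sub c x
  rw [hi] at hxi
  have hm : minCoord x = 0 := by cases c <;> simp at hxi <;> linarith
  obtain ⟨-, -, -, -, hx⟩ := coord_bounds x
  have h0 := hi 0
  have h1 := hi 1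
  have h2 := hi 2
  simp only [coneMap_apply, hm, mul_zero, ite_self] at h0 h1 h2
  linarith

lemma exists_coneMap_eq {v : EuclideanSpace ℝ (Fin 3)} (hv : v ≠ 0) :
    ∃ c x, ∃ r : ℝ, 0 < r ∧ v = r • coneMap c x := by
  obtain ⟨m, ⟨k, hk⟩, hm⟩ : ∃ m : ℝ, (∃ k, v k = m) ∧ ∀ i, m ≤ v i := by
    obtain ⟨k, -, hk⟩ := Finset.exists_min_image Finset.univ (fun i => v i) ⟨0, Finset.mem_univ _⟩
    exact ⟨v k, ⟨k, rfl⟩, fun i => hk i (Finset.mem_univ i)⟩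
  -- The vector `v i - m + |m|` is `v` itself if `m ≥ 0`, and `v` shifted by `2 * |m|` along the
  -- diagonal otherwise. It lies in the closed octant with smallest coordinate `|m|`, and dividing
  -- by its sum gives the barycentric coordinates.
  have hpos : 0 < ∑ i, (v i - m + |m|) := by
    refine lt_of_le_of_ne
      (Finset.sum_nonneg fun i _ => add_nonneg (sub_nonneg.2 (hm i)) (abs_nonneg m)) fun h => hv ?_
    have h' := (Finset.sum_eq_zero_iff_of_nonneg
      (fun i _ => add_nonneg (sub_nonneg.2 (hm i)) (abs_nonneg m))).1 h.symm
    have hm0 : m = 0 := by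
      have := h' k (Finset.mem_univ k)
      rw [hk] at this
      simpa using this
    ext i
    have := h' i (Finset.mem_univ i)
    simpa [hm0] using this
  set s := ∑ i, (v i - m + |m|) with hs
  let x : Triangle := ⟨fun i => (v i - m + |m|) / s,
    fun i => div_nonneg (add_nonneg (sub_nonneg.2 (hm i)) (abs_nonneg m)) hpos.le, by
      rw [← Finset.sum_div, ← hs, div_self hpos.ne']⟩
  have hx : ∀ i, s * x.1 i = v i - m + |m| := fun i => mul_div_cancel₀ _ hpos.ne'
  have hmx : s * minCoord x = |m| := by
    refine le_antisymm ?_ ?_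
    · have := mul_le_mul_of_nonneg_left (minCoord_le x k) hpos.le
      rw [hx, hk] at this
      linarith
    · obtain ⟨i, hi⟩ := exists_eq_minCoord x
      rw [← hi, hx]
      linarith [hm i]
  refine ⟨decide (m < 0), x, s, hpos, ?_⟩
  ext i
  change v i = s * coneMap _ x i
  rw [coneMap_apply, mul_sub, hx]
  by_cases h : m < 0
  · simp only [h, decide_true, if_true]
    rw [abs_of_neg h] at hmx ⊢
    linarith
  · simp only [h, decide_false]
    rw [abs_of_nonneg (not_lt.1 h)]
    simp

/-- The sphere in `ℝ³`. -/
abbrev Sphere : Type := Metric.sphere (0 : EuclideanSpace ℝ (Fin 3)) 1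

/-- Radial projection of the two faces to the sphere. -/
noncomputable def sphereMap (c : Bool) (x : Triangle) : Sphere :=
  ⟨‖coneMap c x‖⁻¹ • coneMap c x, by
    rw [mem_sphere_zero_iff_norm, norm_smul, norm_inv, norm_norm,
      inv_mul_cancel₀ (norm_ne_zero_iff.2 (coneMap_ne_zero c x))]⟩

lemma continuous_sphereMap (c : Bool) : Continuous (sphereMap c) :=
  Continuous.subtype_mk (((continuous_coneMap c).norm.inv₀ fun x =>
    norm_ne_zero_iff.2 (coneMap_ne_zero c x)).smul (continuous_coneMap c)) _

lemma sphereMap_eq {c d : Bool} {x y : Triangle} (h : sphereMap c x = sphereMap d y) :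
    x = y ∧ (c ≠ d → minCoord x = 0) := by
  have hx := norm_pos_iff.2 (coneMap_ne_zero c x)
  have hy := norm_pos_iff.2 (coneMap_ne_zero d y)
  refine coneMap_eq_smul (mul_pos hx (inv_pos.2 hy)) ?_
  have h' : ‖coneMap c x‖⁻¹ • coneMap c x = ‖coneMap d y‖⁻¹ • coneMap d y :=
    congrArg Subtype.val h
  rw [mul_smul, ← h', smul_smul, mul_inv_cancel₀ hx.ne', one_smul]

lemma sphereMap_congr {x : Triangle} (hx : minCoord x = 0) (c d : Bool) :
    sphereMap c x = sphereMap d x := by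
  have : coneMap c x = coneMap d x := by
    ext i
    simp [coneMap_apply, hx]
  simp only [sphereMap, this]

lemma exists_sphereMap_eq (p : Sphere) : ∃ c x, sphereMap c x = p := by
  have hp : ‖(p : EuclideanSpace ℝ (Fin 3))‖ = 1 := mem_sphere_zero_iff_norm.1 p.2
  obtain ⟨c, x, r, hr, h⟩ := exists_coneMap_eq (v := p) (norm_ne_zero_iff.1 (by rw [hp]; simp))
  refine ⟨c, x, Subtype.ext ?_⟩
  have hx := norm_pos_iff.2 (coneMap_ne_zero c x)
  rw [h, norm_smul, Real.norm_of_nonneg hr.le] at hp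
  change ‖coneMap c x‖⁻¹ • coneMap c x = _
  rw [h]
  congr 1
  field_simp
  linarith

lemma minCoord_eq_zero {x : Triangle} {i : Fin 3} (h : x.1 i = 0) : minCoord x = 0 :=
  le_antisymm (h ▸ minCoord_le x i) (minCoord_nonneg x)

/-- The `i`-th vertex. -/
noncomputable def vertex (i : Fin 3) : Triangle :=
  ⟨Pi.single i 1, single_mem_stdSimplex ℝ i⟩

lemma mem_vertices_iff_exists (x : Triangle) : x ∈ vertices ↔ ∃ i, x = vertex i := by
  constructor
  · rintro ⟨i, hi⟩
    refine ⟨i, Subtype.ext (funext fun j => ?_)⟩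
    have hs := x.2.2
    rw [Fin.sum_univ_three] at hs
    have := x.2.1 0; have := x.2.1 1; have := x.2.1 2
    fin_cases i <;> fin_cases j <;> simp [vertex] at * <;> linarith
  · rintro ⟨i, rfl⟩
    exact ⟨i, by simp [vertex]⟩

lemma vertex_injective : Function.Injective vertex := by
  intro i j h
  have := congrArg (fun x : Triangle => x.1 i) h
  by_contra hij
  simp [vertex, hij] at this

lemma minCoord_vertex {x : Triangle} (hx : x ∈ vertices) : minCoord x = 0 := by
  obtain ⟨i, rfl⟩ := (mem_vertices_iff_exists x).1 hx
  obtain ⟨j, hj⟩ := exists_ne i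
  exact minCoord_eq_zero (i := j) (by simp [vertex, hj])

/-- The sphere as the union of two triangles. -/
noncomputable def sphereTriangulation :
    ColoredTriangulation Sphere (Set.range fun i => sphereMap false (vertex i)) where
  Face := Bool
  finite_face := inferInstance
  nonempty_face := inferInstance
  param := sphereMap
  color := id
  continuous_param := continuous_sphereMap
  param_mem_iff c x := by
    rw [mem_vertices_iff_exists]
    constructor
    · rintro ⟨i, hi⟩
      exact ⟨i, (sphereMap_eq hi).1.symm⟩
    · rintro ⟨i, rfl⟩
      exact ⟨i, sphereMap_congr (minCoord_vertex ((mem_vertices_iff_exists _).2 ⟨i, rfl⟩)) _ _⟩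
  exists_param_eq p _ := exists_sphereMap_eq p
  eq_or_edge c d x y hx hy h := by
    obtain ⟨rfl, h0⟩ := sphereMap_eq h
    by_cases hcd : c = d
    · exact Or.inl ⟨hcd, rfl⟩
    · obtain ⟨i, hi⟩ := exists_eq_minCoord x
      have he := mem_openEdge_of_eq_zero hx (hi.trans (h0 hcd))
      exact Or.inr ⟨hcd, i, i, he, he, Set.image_congr fun z hz =>
        sphereMap_congr (minCoord_eq_zero hz.1) c d⟩

lemma exists_sphere_triangulation :
    ∃ P : Finset Sphere, P.card = 3 ∧ Nonempty (ColoredTriangulation Sphere (P : Set Sphere)) := by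
  classical
  refine ⟨Finset.univ.image fun i => sphereMap false (vertex i), ?_, ⟨?_⟩⟩
  · rw [Finset.card_image_of_injective _ fun i j h => vertex_injective (sphereMap_eq h).1]
    simp
  · rw [Finset.coe_image, Finset.coe_univ, Set.image_univ]
    exact sphereTriangulation


/-! ### Homogeneity of connected surfaces -/

open Topology

/-- The centre of an open ball can be moved to any other point of the ball by a homeomorphism
supported in the closed ball. -/
lemma exists_homeomorph_ball {E : Type*} [NormedAddCommGroup E] [NormedSpace ℝ E] [CompleteSpace E]
    {a b : E} {r : ℝ} (hb : b ∈ Metric.ball a r) :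
    ∃ h : E ≃ₜ E, h a = b ∧ ∀ z ∉ Metric.closedBall a r, h z = z := by
  rw [Metric.mem_ball, dist_eq_norm] at hb
  have hr : 0 < r := (norm_nonneg _).trans_lt hb
  -- The cone-shaped bump is `1 / r`-Lipschitz, so `f` differs from the identity by a map of
  -- Lipschitz constant `‖b - a‖ / r < 1`. Such a perturbation of the identity is a homeomorphism.
  let f : E → E := fun z => z + (max 0 (1 - ‖z - a‖ / r)) • (b - a)
  let c : NNReal := ⟨‖b - a‖ / r, by positivity⟩
  have hc : (c : ℝ) < 1 := (div_lt_one hr).2 hb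
  have hf : ApproximatesLinearOn f (ContinuousLinearEquiv.refl ℝ E : E →L[ℝ] E) Set.univ c := by
    intro x _ y _
    have e : f x - f y - (ContinuousLinearEquiv.refl ℝ E : E →L[ℝ] E) (x - y) =
        (max 0 (1 - ‖x - a‖ / r) - max 0 (1 - ‖y - a‖ / r)) • (b - a) := by
      simp only [f, ContinuousLinearEquiv.coe_refl, ContinuousLinearMap.id_apply, sub_smul]
      abel
    rw [e, norm_smul, Real.norm_eq_abs]
    have h1 : |max 0 (1 - ‖x - a‖ / r) - max 0 (1 - ‖y - a‖ / r)| ≤ ‖x - y‖ / r := by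
      have h2 := abs_max_sub_max_le_max (0 : ℝ) (1 - ‖x - a‖ / r) 0 (1 - ‖y - a‖ / r)
      refine h2.trans (max_le (by simp; positivity) ?_)
      have h3 : 1 - ‖x - a‖ / r - (1 - ‖y - a‖ / r) = (‖y - a‖ - ‖x - a‖) / r := by ring
      rw [h3, abs_div, abs_of_pos hr]
      gcongr
      refine (abs_norm_sub_norm_le _ _).trans (le_of_eq ?_)
      rw [sub_sub_sub_cancel_right, norm_sub_rev]
    calc _ ≤ ‖x - y‖ / r * ‖b - a‖ := by gcongr
      _ = c * ‖x - y‖ := by change _ = ‖b - a‖ / r * ‖x - y‖; ring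
  have hc' : Subsingleton E ∨
      c < ‖((ContinuousLinearEquiv.refl ℝ E).symm : E →L[ℝ] E)‖₊⁻¹ := by
    rcases subsingleton_or_nontrivial E with h | h
    · exact Or.inl h
    · right
      have : ‖((ContinuousLinearEquiv.refl ℝ E).symm : E →L[ℝ] E)‖₊ = 1 := by
        ext
        simp
      rw [this, inv_one]
      exact hc
  refine ⟨hf.toHomeomorph f hc', ?_, fun z hz => ?_⟩
  · change f a = b
    simp [f]
  · change f z = z
    rw [Metric.mem_closedBall, dist_eq_norm, not_le] at hz
    have : 1 - ‖z - a‖ / r ≤ 0 := by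
      rw [sub_nonpos]; exact ((one_lt_div hr).2 hz).le
    simp [f, max_eq_left this]

/-- A punctured ball of dimension at least two is connected. -/
lemma isPreconnected_ball_diff_center {E : Type*} [NormedAddCommGroup E] [NormedSpace ℝ E]
    (hE : 1 < Module.rank ℝ E) (a : E) {r : ℝ} (hr : 0 < r) :
    IsPreconnected (Metric.ball a r \ {a}) := by
  have h1 : ∀ w : E, 0 < 1 + ‖w‖ := fun w => by positivity
  have hf : Continuous fun w : E => a + (r / (1 + ‖w‖)) • w := by
    have : Continuous fun w : E => r / (1 + ‖w‖) :=
      continuous_const.div (by fun_prop) fun w => (h1 w).ne'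
    fun_prop
  convert (isConnected_compl_singleton_of_one_lt_rank hE (0 : E)).isPreconnected.image _
    hf.continuousOn using 1
  ext z
  simp only [Set.mem_sdiff, Metric.mem_ball, dist_eq_norm, Set.mem_singleton_iff, Set.mem_image,
    Set.mem_compl_iff]
  constructor
  · rintro ⟨hz, hza⟩
    have hpos : 0 < r - ‖z - a‖ := by linarith
    refine ⟨(r - ‖z - a‖)⁻¹ • (z - a), ?_, ?_⟩
    · simpa [hpos.ne', sub_eq_zero] using hza
    · have e : 1 + ‖(r - ‖z - a‖)⁻¹ • (z - a)‖ = r * (r - ‖z - a‖)⁻¹ := by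
        rw [norm_smul, Real.norm_of_nonneg (inv_nonneg.2 hpos.le)]
        field_simp
        ring
      have e2 : r / (1 + ‖(r - ‖z - a‖)⁻¹ • (z - a)‖) * (r - ‖z - a‖)⁻¹ = 1 := by
        rw [e]
        field_simp
      rw [smul_smul, e2, one_smul, add_sub_cancel]
  · rintro ⟨w, hw, rfl⟩
    have := h1 w
    refine ⟨?_, ?_⟩
    · rw [add_sub_cancel_left, norm_smul, Real.norm_of_nonneg (by positivity), div_mul_eq_mul_div,
        div_lt_iff₀ this]
      linarith
    · have : r / (1 + ‖w‖) ≠ 0 := (div_pos hr this).ne'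
      simpa [this] using hw

section Manifold

variable {S E : Type*} [TopologicalSpace S] [NormedAddCommGroup E]

open Classical in
/-- A self-map of the target of a chart, extended by the identity. -/
noncomputable def extendChart (φ : OpenPartialHomeomorph S E) (h : E → E) (p : S) : S :=
  if p ∈ φ.source then φ.symm (h (φ p)) else p

lemma extendChart_of_mem (φ : OpenPartialHomeomorph S E) (h : E → E) {p : S}
    (hp : p ∈ φ.source) : extendChart φ h p = φ.symm (h (φ p)) := if_pos hp

lemma extendChart_eq_self (φ : OpenPartialHomeomorph S E) {h : E → E} {p : S}
    (hp : p ∈ φ.source → h (φ p) = φ p) : extendChart φ h p = p := by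
  by_cases hs : p ∈ φ.source
  · rw [extendChart_of_mem φ h hs, hp hs, φ.left_inv hs]
  · exact if_neg hs

/-- The Hausdorff condition makes the image of the compact set `K` closed in `S`. A point outside
the chart thus has a neighbourhood avoiding it, where the extension is the identity. -/
lemma continuous_extendChart [T2Space S] (φ : OpenPartialHomeomorph S E) {h : E → E} (hc : Continuous h)
    {K : Set E} (hK : IsCompact K) (hKt : K ⊆ φ.target) (hid : ∀ z ∉ K, h z = z)
    (hmaps : ∀ z ∈ φ.target, h z ∈ φ.target) : Continuous (extendChart φ h) := by
  have hcl : IsClosed (φ.symm '' K) :=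
    (hK.image_of_continuousOn (φ.continuousOn_symm.mono hKt)).isClosed
  rw [continuous_iff_continuousAt]
  intro p
  by_cases hp : p ∈ φ.source
  · have h1 : ContinuousOn (fun q => φ.symm (h (φ q))) φ.source :=
      φ.continuousOn_symm.comp (hc.comp_continuousOn φ.continuousOn)
        fun q hq => hmaps _ (φ.map_source hq)
    refine (h1.continuousAt (φ.open_source.mem_nhds hp)).congr ?_
    filter_upwards [φ.open_source.mem_nhds hp] with q hq
    exact (extendChart_of_mem φ h hq).symm
  · have hpK : p ∉ φ.symm '' K := by
      rintro ⟨z, hz, rfl⟩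
      exact hp (φ.map_target (hKt hz))
    refine continuousAt_id.congr ?_
    filter_upwards [hcl.isOpen_compl.mem_nhds hpK] with q hq
    refine (extendChart_eq_self φ fun hqs => hid _ fun hqK => hq ⟨φ q, hqK, φ.left_inv hqs⟩).symm

/-- Homeomorphisms with compact support in the target of a chart extend by the identity. -/
lemma exists_homeomorph_extend [T2Space S] (φ : OpenPartialHomeomorph S E) (h : E ≃ₜ E) {K : Set E}
    (hK : IsCompact K) (hKt : K ⊆ φ.target) (hid : ∀ z ∉ K, h z = z) :
    ∃ H : S ≃ₜ S, (H : S → S) = extendChart φ h := by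
  have hid' : ∀ z ∉ K, h.symm z = z := fun z hz => by
    rw [h.symm_apply_eq, hid z hz]
  have hm : ∀ {h : E ≃ₜ E}, (∀ z ∉ K, h z = z) → ∀ z ∈ K, h z ∈ K := by
    intro h hid z hz
    by_contra hn
    have := h.injective (hid _ hn)
    exact hn (this.symm ▸ hz)
  have hmaps : ∀ {h : E ≃ₜ E}, (∀ z ∉ K, h z = z) → ∀ z ∈ φ.target, h z ∈ φ.target := by
    intro h hid z hz
    by_cases hzK : z ∈ K
    · exact hKt (hm hid z hzK)
    · rwa [hid z hzK]
  have hinv : ∀ {h k : E ≃ₜ E}, (∀ z ∉ K, h z = z) → (∀ z, k (h z) = z) → ∀ p,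
      extendChart φ k (extendChart φ h p) = p := by
    intro h k hid hk p
    by_cases hp : p ∈ φ.source
    · have hq := hmaps hid _ (φ.map_source hp)
      rw [extendChart_of_mem φ h hp, extendChart_of_mem φ k (φ.map_target hq), φ.right_inv hq, hk,
        φ.left_inv hp]
    · have e : ∀ k : E → E, extendChart φ k p = p := fun k =>
        extendChart_eq_self φ fun h => absurd h hp
      rw [e h, e k]
  exact ⟨⟨⟨extendChart φ h, extendChart φ h.symm, hinv hid h.symm_apply_apply,
    hinv hid' h.apply_symm_apply⟩,
    continuous_extendChart φ h.continuous hK hKt hid (hmaps hid),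
    continuous_extendChart φ h.symm.continuous hK hKt hid' (hmaps hid')⟩, rfl⟩

variable (E) [NormedSpace ℝ E] [T2Space S] [ChartedSpace E S]

/-- Points can be moved locally by homeomorphisms supported in a given open set. -/
lemma eventually_exists_homeomorph [FiniteDimensional ℝ E] {U : Set S} (hU : IsOpen U) {p : S} (hp : p ∈ U) :
    ∀ᶠ q in 𝓝 p, ∃ H : S ≃ₜ S, H p = q ∧ ∀ z ∉ U, H z = z := by
  have : ProperSpace E := FiniteDimensional.proper ℝ E
  have : CompleteSpace E := FiniteDimensional.complete ℝ E
  let φ := chartAt E p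
  have hps : p ∈ φ.source := mem_chart_source E p
  have hV : IsOpen (φ.target ∩ φ.symm ⁻¹' U) := φ.isOpen_inter_preimage_symm hU
  have hpV : φ p ∈ φ.target ∩ φ.symm ⁻¹' U :=
    ⟨φ.map_source hps, by rwa [Set.mem_preimage, φ.left_inv hps]⟩
  obtain ⟨r, hr, hrV⟩ := Metric.nhds_basis_closedBall.mem_iff.1 (hV.mem_nhds hpV)
  have hnear : ∀ᶠ q in 𝓝 p, φ q ∈ Metric.ball (φ p) r :=
    (φ.continuousAt hps).eventually (Metric.ball_mem_nhds _ hr)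
  filter_upwards [hnear, φ.open_source.mem_nhds hps] with q hq hqs
  obtain ⟨h, h1, h2⟩ := exists_homeomorph_ball hq
  obtain ⟨H, hH⟩ := exists_homeomorph_extend φ h (isCompact_closedBall _ _)
    (hrV.trans Set.inter_subset_left) h2
  refine ⟨H, ?_, fun z hz => ?_⟩
  · rw [hH, extendChart_of_mem φ h hps, h1, φ.left_inv hqs]
  · rw [hH]
    refine extendChart_eq_self φ fun hzs => h2 _ fun hzb => hz ?_
    have := (hrV hzb).2
    rwa [Set.mem_preimage, φ.left_inv hzs] at this

/-- In a connected open set, any point can be moved to any other one. -/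
lemma exists_homeomorph_of_isPreconnected [FiniteDimensional ℝ E] {U : Set S} (hU : IsOpen U) (hc : IsPreconnected U)
    {p q : S} (hp : p ∈ U) (hq : q ∈ U) : ∃ H : S ≃ₜ S, H p = q ∧ ∀ z ∉ U, H z = z := by
  -- Being related by such a homeomorphism is a symmetric and transitive relation that holds
  -- locally, so it holds on all of a connected set.
  refine hc.induction₂ (fun p q => ∃ H : S ≃ₜ S, H p = q ∧ ∀ z ∉ U, H z = z) ?_ ?_ ?_ hp hq
  · exact fun x hx =>
      (eventually_exists_homeomorph E hU hx).filter_mono nhdsWithin_le_nhds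
  · rintro x y z - - - ⟨H, rfl, h⟩ ⟨H', rfl, h'⟩
    exact ⟨H.trans H', rfl, fun z hz => by
      rw [Homeomorph.trans_apply, h z hz, h' z hz]⟩
  · rintro x y - - ⟨H, rfl, h⟩
    exact ⟨H.symm, H.symm_apply_apply x, fun z hz => by rw [H.symm_apply_eq, h z hz]⟩

/-- Removing a point does not disconnect a connected open set of dimension at least two. -/
lemma isPreconnected_diff_singleton (hE : 1 < Module.rank ℝ E) {U : Set S} (hU : IsOpen U)
    (hc : IsPreconnected U) (p : S) : IsPreconnected (U \ {p}) := by
  by_cases hpU : p ∈ U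
  swap
  · rwa [Set.sdiff_singleton_eq_self hpU]
  let φ := chartAt E p
  have hps : p ∈ φ.source := mem_chart_source E p
  have hV : IsOpen (φ.target ∩ φ.symm ⁻¹' U) := φ.isOpen_inter_preimage_symm hU
  have hpV : φ p ∈ φ.target ∩ φ.symm ⁻¹' U :=
    ⟨φ.map_source hps, by rwa [Set.mem_preimage, φ.left_inv hps]⟩
  obtain ⟨r, hr, hrV⟩ := Metric.nhds_basis_ball.mem_iff.1 (hV.mem_nhds hpV)
  set B : Set S := φ.symm '' Metric.ball (φ p) r with hB
  have hBopen : IsOpen B :=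
    φ.symm.isOpen_image_of_subset_source Metric.isOpen_ball (hrV.trans Set.inter_subset_left)
  have hpB : p ∈ B := ⟨φ p, Metric.mem_ball_self hr, φ.left_inv hps⟩
  have hBU : B ⊆ U := by
    rintro _ ⟨z, hz, rfl⟩
    exact (hrV hz).2
  have hBc : IsPreconnected (B \ {p}) := by
    have e : B \ {p} = φ.symm '' (Metric.ball (φ p) r \ {φ p}) := by
      ext q
      constructor
      · rintro ⟨⟨z, hz, rfl⟩, hq⟩
        refine ⟨z, ⟨hz, ?_⟩, rfl⟩
        rintro rfl
        exact hq (φ.left_inv hps)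
      · rintro ⟨z, ⟨hz, hz'⟩, rfl⟩
        refine ⟨⟨z, hz, rfl⟩, fun h => hz' ?_⟩
        rw [Set.mem_singleton_iff] at h ⊢
        rw [← h, φ.right_inv (hrV hz).1]
    rw [e]
    refine IsPreconnected.image ?_ _ (φ.continuousOn_symm.mono
      (Set.sdiff_subset.trans (hrV.trans Set.inter_subset_left)))
    exact isPreconnected_ball_diff_center hE _ hr
  rw [isPreconnected_iff_subset_of_disjoint]
  -- If the connected punctured ball lies in `u`, refilling `p` turns a separation of `U \ {p}` into
  -- the separation `u ∪ B`, `v \ {p}` of `U`. Since `p` is in `U`, the second set cannot contain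
  -- `U`.
  have key : ∀ u v : Set S, IsOpen u → IsOpen v → U \ {p} ⊆ u ∪ v → U \ {p} ∩ (u ∩ v) = ∅ →
      B \ {p} ⊆ u → U \ {p} ⊆ u ∨ U \ {p} ⊆ v := by
    intro u v hu hv huv hd hBu
    have hv' : IsOpen (v \ {p}) := hv.sdiff isClosed_singleton
    have hcov : U ⊆ (u ∪ B) ∪ (v \ {p}) := by
      intro q hq
      by_cases hqp : q = p
      · exact Or.inl (Or.inr (hqp ▸ hpB))
      · rcases huv ⟨hq, hqp⟩ with h | h
        · exact Or.inl (Or.inl h)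
        · exact Or.inr ⟨h, hqp⟩
    have hdis : U ∩ ((u ∪ B) ∩ (v \ {p})) = ∅ := by
      refine Set.eq_empty_iff_forall_notMem.2 ?_
      rintro q ⟨hq, hq1, hq2⟩
      have : q ∈ u := by
        rcases hq1 with h | h
        · exact h
        · exact hBu ⟨h, hq2.2⟩
      exact Set.eq_empty_iff_forall_notMem.1 hd q ⟨⟨hq, hq2.2⟩, this, hq2.1⟩
    rcases isPreconnected_iff_subset_of_disjoint.1 hc (u ∪ B) (v \ {p}) (hu.union hBopen) hv'
      hcov hdis with h | h
    · left
      intro q hq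
      rcases h hq.1 with h | h
      · exact h
      · exact hBu ⟨h, hq.2⟩
    · exact absurd rfl (h hpU).2
  intro u v hu hv huv hd
  rcases isPreconnected_iff_subset_of_disjoint.1 hBc u v hu hv
    ((Set.sdiff_subset_sdiff_left hBU).trans huv)
    (Set.subset_empty_iff.1 (hd ▸ Set.inter_subset_inter_left _ (Set.sdiff_subset_sdiff_left hBU)))
    with h | h
  · exact key u v hu hv huv hd h
  · exact (key v u hv hu (by rwa [Set.union_comm]) (by rwa [Set.inter_comm v u]) h).symm

lemma isPreconnected_compl_finset [PreconnectedSpace S] (hE : 1 < Module.rank ℝ E) (F : Finset S) :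
    IsPreconnected ((F : Set S)ᶜ) := by
  classical
  induction F using Finset.induction_on with
  | empty => simpa using isPreconnected_univ
  | insert a F _ ih =>
    have := isPreconnected_diff_singleton E hE (U := (F : Set S)ᶜ)
      F.finite_toSet.isClosed.isOpen_compl ih a
    rwa [Set.sdiff_eq, ← Set.compl_union, Set.union_singleton, ← Finset.coe_insert] at this

/-- A connected manifold of dimension at least two is `n`-homogeneous for all `n`. -/
theorem exists_homeomorph_image_eq [FiniteDimensional ℝ E] [PreconnectedSpace S] (hE : 1 < Module.rank ℝ E)
    {P Q : Finset S} (h : P.card = Q.card) : ∃ H : S ≃ₜ S, H '' (P : Set S) = Q := by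
  classical
  induction P using Finset.induction_on generalizing Q with
  | empty =>
    rw [Finset.card_empty, eq_comm, Finset.card_eq_zero] at h
    exact ⟨Homeomorph.refl S, by simp [h]⟩
  | insert a P ha ih =>
    rw [Finset.card_insert_of_notMem ha, eq_comm, Finset.card_eq_succ] at h
    obtain ⟨b, Q, hb, rfl, hQ⟩ := h
    obtain ⟨H, hH⟩ := ih hQ.symm
    have hHa : H a ∈ ((Q : Set S))ᶜ := by
      rw [← hH]
      rintro ⟨x, hx, hxa⟩
      exact ha (H.injective hxa ▸ hx)
    -- The last point is moved within the complement of `Q`, so the points already placed stay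
    -- fixed.
    obtain ⟨H', h1, h2⟩ := exists_homeomorph_of_isPreconnected E
      Q.finite_toSet.isClosed.isOpen_compl (isPreconnected_compl_finset E hE Q) hHa
      (q := b) (by simpa using hb)
    refine ⟨H.trans H', ?_⟩
    have e : H' '' (Q : Set S) = Q := by
      conv_rhs => rw [← Set.image_id (Q : Set S)]
      exact Set.image_congr fun z hz => h2 z (by simpa using hz)
    change H' ∘ H '' _ = _
    rw [Set.image_comp, Finset.coe_insert, Set.image_insert_eq, hH,
      Set.image_insert_eq, h1, e, Finset.coe_insert]

end Manifold

/-! ### Orientation of triples of points of the plane -/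

/-- Twice the signed area of a triangle. -/
def orient (p q z : ℂ) : ℝ :=
  (q.re - p.re) * (z.im - p.im) - (q.im - p.im) * (z.re - p.re)

lemma orient_rotate (p q z : ℂ) : orient q z p = orient p q z := by unfold orient; ring

lemma orient_swap (p q z : ℂ) : orient p z q = -orient p q z := by unfold orient; ring

lemma orient_swap_left (p q z : ℂ) : orient q p z = -orient p q z := by unfold orient; ring

lemma orient_left (p q : ℂ) : orient p q p = 0 := by unfold orient; ring

lemma orient_right (p q : ℂ) : orient p q q = 0 := by unfold orient; ring

lemma orient_sum (p q : ℂ) (w : Fin 3 → ℂ) (x : Triangle) :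
    orient p q (∑ m, x.1 m • w m) = ∑ m, x.1 m * orient p q (w m) := by
  have h := x.2.2
  simp only [Fin.sum_univ_three] at h ⊢
  simp [orient]
  linear_combination (-((q.re - p.re) * (0 - p.im) - (q.im - p.im) * (0 - p.re))) * h

/-- Barycentric coordinates as areas. -/
lemma orient_smul_eq (a b c z : ℂ) :
    orient a b c • z = orient b c z • a + orient c a z • b + orient a b z • c := by
  apply Complex.ext <;> simp [orient] <;> ring

lemma orient_add_eq (a b c z : ℂ) :
    orient b c z + orient c a z + orient a b z = orient a b c := by
  unfold orient; ring

/-- The barycentric coordinates are the ratios of the three sub-areas to the total area. The third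
hypothesis is stated for the pair `0, 2` because corners of faces are numbered increasingly. -/
lemma exists_barycentric {w : Fin 3 → ℂ} (hw : 0 < orient (w 0) (w 1) (w 2)) {z : ℂ}
    (h01 : 0 ≤ orient (w 0) (w 1) z) (h12 : 0 ≤ orient (w 1) (w 2) z)
    (h02 : orient (w 0) (w 2) z ≤ 0) : ∃ x : Triangle, ∑ m, x.1 m • w m = z := by
  rw [orient_swap_left] at h02
  have h20 : 0 ≤ orient (w 2) (w 0) z := by linarith
  set D := orient (w 0) (w 1) (w 2)
  refine ⟨⟨![orient (w 1) (w 2) z / D, orient (w 2) (w 0) z / D, orient (w 0) (w 1) z / D], ?_, ?_⟩,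
    ?_⟩
  · intro m
    fin_cases m <;> simp <;> positivity
  · rw [Fin.sum_univ_three]
    simp only [Matrix.cons_val]
    rw [← add_div, ← add_div, orient_add_eq, div_self hw.ne']
  · have e := orient_smul_eq (w 0) (w 1) (w 2) z
    rw [Fin.sum_univ_three]
    simp only [Matrix.cons_val]
    refine Eq.trans ?_ (inv_smul_smul₀ hw.ne' z)
    rw [e, smul_add, smul_add, smul_smul, smul_smul, smul_smul]
    simp only [div_eq_inv_mul]

lemma barycentric_injective {w : Fin 3 → ℂ} (hw : 0 < orient (w 0) (w 1) (w 2)) {x y : Triangle}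
    (h : ∑ m, x.1 m • w m = ∑ m, y.1 m • w m) : x = y := by
  have key : ∀ p q : ℂ, ∑ m, x.1 m * orient p q (w m) = ∑ m, y.1 m * orient p q (w m) := by
    intro p q
    rw [← orient_sum, ← orient_sum, h]
  have h0 := key (w 1) (w 2)
  have h1 := key (w 2) (w 0)
  have h2 := key (w 0) (w 1)
  simp only [Fin.sum_univ_three, orient_left, orient_right, mul_zero, add_zero, zero_add] at h0 h1 h2
  rw [orient_rotate] at h0
  rw [orient_rotate, orient_rotate] at h1
  refine Subtype.ext (funext fun m => ?_)
  fin_cases m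
  · exact mul_right_cancel₀ hw.ne' h0
  · exact mul_right_cancel₀ hw.ne' h1
  · exact mul_right_cancel₀ hw.ne' h2

/-- Points of the unit circle are extreme. -/
lemma eq_of_sum_eq_of_norm_eq_one {w : Fin 3 → ℂ} (hw : ∀ m, ‖w m‖ = 1) {u : ℂ} (hu : ‖u‖ = 1)
    {x : Triangle} (h : ∑ m, x.1 m • w m = u) {m : Fin 3} (hm : 0 < x.1 m) : w m = u := by
  have sq : ∀ {v : ℂ}, ‖v‖ = 1 → v.re ^ 2 + v.im ^ 2 = 1 := fun {v} hv => by
    have := Complex.sq_norm v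
    rw [hv, Complex.normSq_apply] at this
    linarith
  have hre := congrArg Complex.re h
  have him := congrArg Complex.im h
  have hs := x.2.2
  have hx := x.2.1
  have hu' := sq hu
  -- The weighted mean of the squared distances from `u` to the `w m` is `2 - 2 * ‖u‖ ^ 2 = 0`, so
  -- each point of positive weight is `u`.
  have key : ∑ m, x.1 m * ((u.re - (w m).re) ^ 2 + (u.im - (w m).im) ^ 2) = 0 := by
    have h0 := sq (hw 0)
    have h1 := sq (hw 1)
    have h2 := sq (hw 2)
    simp [Fin.sum_univ_three] at hre him hs ⊢
    linear_combination x.1 0 * h0 + x.1 1 * h1 + x.1 2 * h2 - 2 * u.re * hre - 2 * u.im * him +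
      (1 + (u.re ^ 2 + u.im ^ 2)) * hs - hu'
  rw [Finset.sum_eq_zero_iff_of_nonneg fun m _ => mul_nonneg (hx m) (by positivity)] at key
  have := (mul_eq_zero.1 (key m (Finset.mem_univ m))).resolve_left hm.ne'
  have e1 : (u.re - (w m).re) ^ 2 = 0 := by
    nlinarith [sq_nonneg (u.re - (w m).re), sq_nonneg (u.im - (w m).im)]
  have e2 : (u.im - (w m).im) ^ 2 = 0 := by
    nlinarith [sq_nonneg (u.re - (w m).re), sq_nonneg (u.im - (w m).im)]
  apply Complex.ext
  · linarith [pow_eq_zero_iff (two_ne_zero) |>.1 e1]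
  · linarith [pow_eq_zero_iff (two_ne_zero) |>.1 e2]

/-! ### The vertices of the regular polygon -/

section Polygon

variable {g : ℕ}

lemma polygonVertex_eq (g j : ℕ) : polygonVertex g j =
    Complex.exp ((2 * Real.pi * (j / (4 * g)) : ℝ) * Complex.I) := by
  unfold polygonVertex
  congr 1
  push_cast
  ring

lemma norm_polygonVertex (g j : ℕ) : ‖polygonVertex g j‖ = 1 := by
  rw [polygonVertex_eq, Complex.norm_exp_ofReal_mul_I]

lemma polygonVertex_add (hg : 0 < g) (j : ℕ) : polygonVertex g (j + 4 * g) = polygonVertex g j := by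
  unfold polygonVertex
  have : (g : ℂ) ≠ 0 := by exact_mod_cast hg.ne'
  rw [← Complex.exp_periodic (2 * (Real.pi : ℂ) * Complex.I * ((j : ℂ) / (4 * (g : ℂ))))]
  congr 1
  push_cast
  field_simp

lemma polygonVertex_mod (hg : 0 < g) (j : ℕ) :
    polygonVertex g (j % (4 * g)) = polygonVertex g j :=
  Function.Periodic.map_mod_nat (polygonVertex_add hg) j

/-- With `p` and `q` half the arcs from `i` to `j` and from `j` to `k`, twice the area of the
inscribed triangle is `4 sin p sin q sin (p + q)`, where `p + q < π`. -/
lemma orient_polygonVertex_pos (hg : 0 < g) {i j k : ℕ} (hij : i < j) (hjk : j < k)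
    (hki : k < i + 4 * g) :
    0 < orient (polygonVertex g i) (polygonVertex g j) (polygonVertex g k) := by
  have hg' : (0 : ℝ) < g := by exact_mod_cast hg
  have hN : (0 : ℝ) < 4 * g := by positivity
  obtain ⟨p, hp⟩ : ∃ p : ℝ, p = Real.pi * ((j - i) / (4 * g)) := ⟨_, rfl⟩
  obtain ⟨q, hq⟩ : ∃ q : ℝ, q = Real.pi * ((k - j) / (4 * g)) := ⟨_, rfl⟩
  have hij' : (i : ℝ) < j := by exact_mod_cast hij
  have hjk' : (j : ℝ) < k := by exact_mod_cast hjk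
  have hki' : (k : ℝ) < i + 4 * g := by exact_mod_cast hki
  have hp0 : 0 < p := by rw [hp]; exact mul_pos Real.pi_pos (div_pos (by linarith) hN)
  have hq0 : 0 < q := by rw [hq]; exact mul_pos Real.pi_pos (div_pos (by linarith) hN)
  have hpq : p + q < Real.pi := by
    have e : p + q = Real.pi * ((k - i) / (4 * g)) := by rw [hp, hq]; ring
    rw [e]
    exact mul_lt_of_lt_one_right Real.pi_pos ((div_lt_one hN).2 (by linarith))
  have e : orient (polygonVertex g i) (polygonVertex g j) (polygonVertex g k) =
      4 * Real.sin p * Real.sin q * Real.sin (p + q) := by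
    have h1 : 2 * Real.pi * (j / (4 * g)) - 2 * Real.pi * (i / (4 * g)) = 2 * p := by rw [hp]; ring
    have h2 : 2 * Real.pi * (k / (4 * g)) - 2 * Real.pi * (j / (4 * g)) = 2 * q := by rw [hq]; ring
    have h3 : 2 * Real.pi * (k / (4 * g)) - 2 * Real.pi * (i / (4 * g)) = 2 * (p + q) := by
      rw [hp, hq]; ring
    have e1 : orient (polygonVertex g i) (polygonVertex g j) (polygonVertex g k) =
        Real.sin (2 * p) + Real.sin (2 * q) - Real.sin (2 * (p + q)) := by
      rw [← h1, ← h2, ← h3, Real.sin_sub, Real.sin_sub, Real.sin_sub]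
      simp only [orient, polygonVertex_eq, Complex.exp_ofReal_mul_I_re,
        Complex.exp_ofReal_mul_I_im]
      ring
    rw [e1, Real.sin_two_mul, Real.sin_two_mul, Real.sin_two_mul, Real.sin_add, Real.cos_add]
    linear_combination (-2 * Real.sin p * Real.cos p) * Real.sin_sq_add_cos_sq q +
      (-2 * Real.sin q * Real.cos q) * Real.sin_sq_add_cos_sq p
  rw [e]
  have s1 := Real.sin_pos_of_pos_of_lt_pi hp0 (by linarith)
  have s2 := Real.sin_pos_of_pos_of_lt_pi hq0 (by linarith)
  have s3 := Real.sin_pos_of_pos_of_lt_pi (by linarith) hpq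
  positivity

/-- A third vertex would span a triangle of positive area with the two. It is `j + 1`, unless that
wraps around to `i`; then `i + 1` lies between them. -/
lemma polygonVertex_ne (hg : 0 < g) {i j : ℕ} (hij : i < j) (hj : j < i + 4 * g) :
    polygonVertex g i ≠ polygonVertex g j := by
  intro h
  by_cases hc : j + 1 < i + 4 * g
  · have := orient_polygonVertex_pos hg hij (Nat.lt_succ_self j) hc
    rw [h, orient_rotate, orient_rotate, ← orient_rotate, orient_right] at this
    exact lt_irrefl _ this
  · have := orient_polygonVertex_pos hg (Nat.lt_succ_self i) (show i + 1 < j by omega) hj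
    rw [h, orient_left] at this
    exact lt_irrefl _ this

lemma polygonVertex_injective (hg : 0 < g) {i j : ℕ} (hi : i < 4 * g) (hj : j < 4 * g)
    (h : polygonVertex g i = polygonVertex g j) : i = j := by
  rcases lt_trichotomy i j with h' | h' | h'
  · exact absurd h (polygonVertex_ne hg h' (by omega))
  · exact h'
  · exact absurd h.symm (polygonVertex_ne hg h' (by omega))

/-- All vertices lie on the same side of the line through two consecutive ones. -/
lemma orient_side (hg : 0 < g) (j m : ℕ) :
    0 ≤ orient (polygonVertex g j) (polygonVertex g (j + 1)) (polygonVertex g m) ∧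
    (orient (polygonVertex g j) (polygonVertex g (j + 1)) (polygonVertex g m) = 0 →
      polygonVertex g m = polygonVertex g j ∨ polygonVertex g m = polygonVertex g (j + 1)) := by
  obtain ⟨d, hd, hm⟩ : ∃ d, d < 4 * g ∧ polygonVertex g m = polygonVertex g (j + d) := by
    -- This represents `m - j` modulo `4 * g` without truncated subtraction.
    refine ⟨(m + (4 * g * j - j)) % (4 * g), Nat.mod_lt _ (by omega), ?_⟩
    rw [← polygonVertex_mod hg m, ← polygonVertex_mod hg (j + _), Nat.add_mod_mod]
    congr 1
    have : j ≤ 4 * g * j := Nat.le_mul_of_pos_left j (by omega)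
    rw [show j + (m + (4 * g * j - j)) = m + 4 * g * j by omega, Nat.add_mul_mod_self_left]
  rw [hm]
  rcases Nat.lt_or_ge 1 d with h | h
  · have := orient_polygonVertex_pos hg (Nat.lt_succ_self j) (show j + 1 < j + d by omega)
      (by omega)
    exact ⟨this.le, fun h => absurd h this.ne'⟩
  · interval_cases d
    · rw [add_zero, orient_left]; simp
    · rw [orient_right]; simp

lemma orient_side_nonneg (hg : 0 < g) (j : ℕ) {z : ℂ} (hz : z ∈ polygon g) :
    0 ≤ orient (polygonVertex g j) (polygonVertex g (j + 1)) z := by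
  have hconv : Convex ℝ {z : ℂ | 0 ≤ orient (polygonVertex g j) (polygonVertex g (j + 1)) z} := by
    intro a ha b hb s t hs ht hst
    simp only [Set.mem_ofPred_eq] at *
    have e : orient (polygonVertex g j) (polygonVertex g (j + 1)) (s • a + t • b) =
        s * orient (polygonVertex g j) (polygonVertex g (j + 1)) a +
        t * orient (polygonVertex g j) (polygonVertex g (j + 1)) b := by
      obtain rfl : s = 1 - t := by linarith
      simp [orient]
      ring
    rw [e]
    positivity
  refine convexHull_min ?_ hconv hz
  rintro _ ⟨m, rfl⟩
  exact (orient_side hg j m).1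

lemma polygonVertex_mem (g j : ℕ) : polygonVertex g j ∈ polygon g :=
  subset_convexHull ℝ _ ⟨j, rfl⟩

/-- The sign of a vertex with respect to a chord. -/
lemma orient_chord (hg : 0 < g) {i j m : ℕ} (hij : i < j) (hj : j < 4 * g) (hm : m < 4 * g) :
    (i < m ∧ m < j → orient (polygonVertex g i) (polygonVertex g j) (polygonVertex g m) < 0) ∧
    (m < i ∨ j < m → 0 < orient (polygonVertex g i) (polygonVertex g j) (polygonVertex g m)) := by
  constructor
  · rintro ⟨h1, h2⟩
    rw [orient_swap]
    have := orient_polygonVertex_pos hg h1 h2 (by omega)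
    linarith
  · rintro (h | h)
    · rw [orient_rotate]
      exact orient_polygonVertex_pos hg h hij (by omega)
    · exact orient_polygonVertex_pos hg hij h (by omega)

/-! ### The side identifications -/

/-- The point with parameter `t` on the `j`-th side. -/
noncomputable def sidePoint (g j : ℕ) (t : ℝ) : ℂ :=
  AffineMap.lineMap (polygonVertex g j) (polygonVertex g (j + 1)) t

lemma sidePoint_eq (g j : ℕ) (t : ℝ) :
    sidePoint g j t = (1 - t) • polygonVertex g j + t • polygonVertex g (j + 1) :=
  AffineMap.lineMap_apply_module _ _ _

lemma lineMap_symm (a b : ℂ) (t : ℝ) :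
    AffineMap.lineMap a b t = AffineMap.lineMap b a (1 - t) :=
  (AffineMap.lineMap_apply_one_sub b a t).symm

/-- The side with which the `j`-th side is identified. -/
def partner (j : ℕ) : ℕ := if j % 4 < 2 then j + 2 else j - 2

lemma partner_partner (j : ℕ) : partner (partner j) = j := by
  unfold partner; split_ifs <;> omega

lemma partner_lt {j : ℕ} (hj : j < 4 * g) : partner j < 4 * g := by
  unfold partner; split_ifs <;> omega

/-- A point of a segment as a degenerate barycentric combination. -/
lemma exists_barycentric_segment (a b : ℂ) {t : ℝ} (ht : t ∈ Set.Icc (0 : ℝ) 1) :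
    ∃ x : Triangle, x.1 = ![1 - t, t, 0] ∧
      ∑ m, x.1 m • (![a, b, b] : Fin 3 → ℂ) m = (1 - t) • a + t • b := by
  refine ⟨⟨![1 - t, t, 0], fun m => ?_, ?_⟩, rfl, ?_⟩
  · fin_cases m <;> simp [ht.1, ht.2]
  · simp [Fin.sum_univ_three]
  · simp [Fin.sum_univ_three]

lemma sidePoint_ne_polygonVertex (hg : 0 < g) (j m : ℕ) {t : ℝ} (ht : t ∈ Set.Ioo (0 : ℝ) 1) :
    sidePoint g j t ≠ polygonVertex g m := by
  intro h
  obtain ⟨x, hx, hs⟩ := exists_barycentric_segment (polygonVertex g j) (polygonVertex g (j + 1))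
    (Set.Ioo_subset_Icc_self ht)
  rw [← sidePoint_eq, h] at hs
  have hw : ∀ m, ‖(![polygonVertex g j, polygonVertex g (j + 1), polygonVertex g (j + 1)] :
      Fin 3 → ℂ) m‖ = 1 := by
    intro m
    fin_cases m <;> exact norm_polygonVertex _ _
  have h0 := eq_of_sum_eq_of_norm_eq_one hw (norm_polygonVertex g m) hs (m := 0)
    (by rw [hx]; simpa using ht.2)
  have h1 := eq_of_sum_eq_of_norm_eq_one hw (norm_polygonVertex g m) hs (m := 1)
    (by rw [hx]; simpa using ht.1)
  exact polygonVertex_ne hg (Nat.lt_succ_self j) (by omega) (h0.trans h1.symm)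

/-- The polygon lies on one side of the line through side `j`. An interior point of side `k` on that
line forces both ends of side `k` onto it, so they are ends of side `j`. -/
lemma sidePoint_injective (hg : 0 < g) {j k : ℕ} (hj : j < 4 * g) (hk : k < 4 * g) {s t : ℝ}
    (hs : s ∈ Set.Ioo (0 : ℝ) 1) (ht : t ∈ Set.Ioo (0 : ℝ) 1)
    (h : sidePoint g j s = sidePoint g k t) : j = k ∧ s = t := by
  have hjk : j = k := by
    obtain ⟨x, hx, hsx⟩ := exists_barycentric_segment (polygonVertex g k)
      (polygonVertex g (k + 1)) (Set.Ioo_subset_Icc_self ht)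
    obtain ⟨y, hy, hsy⟩ := exists_barycentric_segment (polygonVertex g j)
      (polygonVertex g (j + 1)) (Set.Ioo_subset_Icc_self hs)
    have e1 := orient_sum (polygonVertex g j) (polygonVertex g (j + 1))
      ![polygonVertex g k, polygonVertex g (k + 1), polygonVertex g (k + 1)] x
    have e2 := orient_sum (polygonVertex g j) (polygonVertex g (j + 1))
      ![polygonVertex g j, polygonVertex g (j + 1), polygonVertex g (j + 1)] y
    rw [hsx, ← sidePoint_eq, ← h, sidePoint_eq, ← hsy, e2, hx, hy] at e1
    simp [Fin.sum_univ_three, orient_left, orient_right] at e1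
    obtain ⟨p0, z0⟩ := orient_side hg j k
    obtain ⟨p1, z1⟩ := orient_side hg j (k + 1)
    have q0 := mul_nonneg (sub_nonneg.2 ht.2.le) p0
    have q1 := mul_nonneg ht.1.le p1
    have z0 := z0 ((mul_eq_zero.1 (by linarith)).resolve_left (sub_pos.2 ht.2).ne')
    have z1 := z1 ((mul_eq_zero.1 (by linarith)).resolve_left ht.1.ne')
    rcases z0 with z0 | z0
    · exact (polygonVertex_injective hg hk hj z0).symm
    · rcases z1 with z1 | z1
      -- The same side with reversed ends would mean `k = j + 1` and `j = k + 1` modulo `4 * g`,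
      -- impossible since `4 * g > 2`.
      · rw [← polygonVertex_mod hg (k + 1)] at z1
        rw [← polygonVertex_mod hg (j + 1)] at z0
        have a0 := polygonVertex_injective hg hk (Nat.mod_lt _ (by omega)) z0
        have a1 := polygonVertex_injective hg (Nat.mod_lt _ (by omega)) hj z1
        rcases Nat.lt_or_ge (j + 1) (4 * g) with c | c
        · rw [Nat.mod_eq_of_lt c] at a0
          rcases Nat.lt_or_ge (k + 1) (4 * g) with d | d
          · rw [Nat.mod_eq_of_lt d] at a1
            omega
          · rw [show k + 1 = 4 * g by omega, Nat.mod_self] at a1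
            omega
        · rw [show j + 1 = 4 * g by omega, Nat.mod_self] at a0
          subst a0
          rw [Nat.mod_eq_of_lt (by omega)] at a1
          omega
      · exact absurd (z0.trans z1.symm) (polygonVertex_ne hg (Nat.lt_succ_self k) (by omega))
  subst hjk
  refine ⟨rfl, AffineMap.lineMap_injective ℝ ?_ h⟩
  exact polygonVertex_ne hg (Nat.lt_succ_self j) (by omega)

/-- The equivalence relation generated by the side identifications. -/
def SideRel (g : ℕ) (p q : polygon g) : Prop :=
  p = q ∨ ((∃ i, (p : ℂ) = polygonVertex g i) ∧ ∃ i, (q : ℂ) = polygonVertex g i) ∨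
    ∃ j < 4 * g, ∃ t ∈ Set.Ioo (0 : ℝ) 1, (p : ℂ) = sidePoint g j t ∧
      (q : ℂ) = sidePoint g (partner j) (1 - t)

lemma one_sub_mem {t : ℝ} (ht : t ∈ Set.Ioo (0 : ℝ) 1) : 1 - t ∈ Set.Ioo (0 : ℝ) 1 :=
  ⟨by linarith [ht.2], by linarith [ht.1]⟩

lemma SideRel.symm {p q : polygon g} (h : SideRel g p q) : SideRel g q p := by
  rcases h with h | ⟨h1, h2⟩ | ⟨j, hj, t, ht, hp, hq⟩
  · exact Or.inl h.symm
  · exact Or.inr (Or.inl ⟨h2, h1⟩)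
  · exact Or.inr (Or.inr ⟨partner j, partner_lt hj, 1 - t, one_sub_mem ht, hq,
      by rwa [partner_partner, sub_sub_cancel]⟩)

/-- An interior point of a side is not a vertex and determines its side and parameter. Since
`partner` is an involution, gluing twice returns to the starting point. -/
lemma SideRel.trans (hg : 0 < g) {p q r : polygon g} (h : SideRel g p q) (h' : SideRel g q r) :
    SideRel g p r := by
  rcases h with rfl | ⟨h1, h2⟩ | ⟨j, hj, t, ht, hp, hq⟩
  · exact h'
  · rcases h' with rfl | ⟨h3, h4⟩ | ⟨j', hj', t', ht', hp', hq'⟩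
    · exact Or.inr (Or.inl ⟨h1, h2⟩)
    · exact Or.inr (Or.inl ⟨h1, h4⟩)
    · obtain ⟨i, hi⟩ := h2
      exact absurd (hp'.symm.trans hi) (sidePoint_ne_polygonVertex hg _ _ ht')
  · rcases h' with rfl | ⟨⟨i, hi⟩, h4⟩ | ⟨j', hj', t', ht', hp', hq'⟩
    · exact Or.inr (Or.inr ⟨j, hj, t, ht, hp, hq⟩)
    · exact absurd (hq.symm.trans hi) (sidePoint_ne_polygonVertex hg _ _ (one_sub_mem ht))
    · obtain ⟨rfl, rfl⟩ := sidePoint_injective hg (partner_lt hj) hj' (one_sub_mem ht) ht'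
        (hq.symm.trans hp')
      rw [partner_partner, sub_sub_cancel] at hq'
      exact Or.inl (Subtype.ext (hp.trans hq'.symm))

lemma sideRel_of_side {j : ℕ} (hj : j < 4 * g) {t : ℝ} (ht : t ∈ Set.Icc (0 : ℝ) 1)
    {p q : polygon g} (hp : (p : ℂ) = sidePoint g j t)
    (hq : (q : ℂ) = sidePoint g (partner j) (1 - t)) : SideRel g p q := by
  rcases eq_or_lt_of_le ht.1 with h0 | h0
  · subst h0
    exact Or.inr (Or.inl ⟨⟨j, by simpa [sidePoint_eq] using hp⟩,
      ⟨partner j + 1, by simpa [sidePoint_eq] using hq⟩⟩)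
  rcases eq_or_lt_of_le ht.2 with h1 | h1
  · subst h1
    exact Or.inr (Or.inl ⟨⟨j + 1, by simpa [sidePoint_eq] using hp⟩,
      ⟨partner j, by simpa [sidePoint_eq] using hq⟩⟩)
  exact Or.inr (Or.inr ⟨j, hj, t, ⟨h0, h1⟩, hp, hq⟩)

lemma SideIdentification.sideRel {p q : polygon g} (h : SideIdentification g p q) :
    SideRel g p q := by
  cases h with
  | a k hk t ht x y hx hy =>
    refine sideRel_of_side (j := 4 * k) (by omega) ht hx ?_
    rw [hy, lineMap_symm, sidePoint, show partner (4 * k) = 4 * k + 2 by simp [partner]]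
  | b k hk t ht x y hx hy =>
    refine sideRel_of_side (j := 4 * k + 1) (by omega) ht hx ?_
    rw [hy, lineMap_symm, sidePoint, show partner (4 * k + 1) = 4 * k + 3 by
      unfold partner; split_ifs <;> omega]

lemma sideRel_of_mk_eq (hg : 0 < g) {p q : polygon g}
    (h : Quot.mk (SideIdentification g) p = Quot.mk (SideIdentification g) q) :
    SideRel g p q := by
  have h' := Quot.eqvGen_exact h
  clear h
  induction h' with
  | rel _ _ h => exact h.sideRel
  | refl _ => exact Or.inl rfl
  | symm _ _ _ ih => exact ih.symm
  | trans _ _ _ _ _ ih1 ih2 => exact ih1.trans hg ih2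

lemma sidePoint_mem (g j : ℕ) {t : ℝ} (ht : t ∈ Set.Icc (0 : ℝ) 1) : sidePoint g j t ∈ polygon g :=
  (convex_convexHull ℝ _).lineMap_mem (polygonVertex_mem g j) (polygonVertex_mem g (j + 1)) ht

lemma mk_sidePoint {j : ℕ} (hj : j < 4 * g) {t : ℝ} (ht : t ∈ Set.Icc (0 : ℝ) 1)
    {p q : polygon g} (hp : (p : ℂ) = sidePoint g j t)
    (hq : (q : ℂ) = sidePoint g (partner j) (1 - t)) :
    Quot.mk (SideIdentification g) p = Quot.mk (SideIdentification g) q := by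
  have hj' := Nat.div_add_mod j 4
  have hlt := Nat.mod_lt j (show 0 < 4 by norm_num)
  set k := j / 4
  have ht' : 1 - t ∈ Set.Icc (0 : ℝ) 1 := ⟨by linarith [ht.2], by linarith [ht.1]⟩
  have p0 : partner (4 * k) = 4 * k + 2 := by simp [partner]
  have p1 : partner (4 * k + 1) = 4 * k + 3 := by unfold partner; split_ifs <;> omega
  have p2 : partner (4 * k + 2) = 4 * k := by rw [← p0, partner_partner]
  have p3 : partner (4 * k + 3) = 4 * k + 1 := by rw [← p1, partner_partner]
  interval_cases hr : j % 4
  · rw [← hj', add_zero] at hp hq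
    rw [p0] at hq
    exact Quot.sound (.a k (by omega) t ht p q hp (by rw [hq, lineMap_symm]; rfl))
  · rw [← hj'] at hp hq
    rw [p1] at hq
    exact Quot.sound (.b k (by omega) t ht p q hp (by rw [hq, lineMap_symm]; rfl))
  · rw [← hj'] at hp hq
    rw [p2] at hq
    exact (Quot.sound (.a k (by omega) (1 - t) ht' q p hq (by
      rw [hp, lineMap_symm, sub_sub_cancel]; rfl))).symm
  · rw [← hj'] at hp hq
    rw [p3] at hq
    exact (Quot.sound (.b k (by omega) (1 - t) ht' q p hq (by
      rw [hp, lineMap_symm, sub_sub_cancel]; rfl))).symm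

/-- The image of a vertex of the polygon. -/
noncomputable def cornerClass (g i : ℕ) : PolygonSurface g :=
  Quot.mk _ ⟨polygonVertex g i, polygonVertex_mem g i⟩

/-- In a block of four sides, the gluing identifies corner 0 with 3, 1 with 2 and 4, and 2 with 3,
hence all five. Consecutive blocks share a corner. -/
lemma cornerClass_eq (g i : ℕ) (hg : 0 < g) : cornerClass g i = cornerClass g 0 := by
  have e : ∀ j < 4 * g, cornerClass g j = cornerClass g (partner j + 1) ∧
      cornerClass g (j + 1) = cornerClass g (partner j) := by
    intro j hj
    constructor
    · exact mk_sidePoint hj (t := 0) (by simp) (by simp [sidePoint_eq]) (by simp [sidePoint_eq])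
    · exact mk_sidePoint hj (t := 1) (by simp) (by simp [sidePoint_eq]) (by simp [sidePoint_eq])
  have block : ∀ k < g, ∀ r ≤ 4, cornerClass g (4 * k + r) = cornerClass g (4 * k) := by
    intro k hk
    have a := e (4 * k) (by omega)
    have b := e (4 * k + 1) (by omega)
    rw [show partner (4 * k) = 4 * k + 2 by simp [partner]] at a
    rw [show partner (4 * k + 1) = 4 * k + 3 by unfold partner; split_ifs <;> omega] at b
    have h3 : cornerClass g (4 * k + 3) = cornerClass g (4 * k) := a.1.symm
    have h2 : cornerClass g (4 * k + 2) = cornerClass g (4 * k) := b.2.trans h3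
    have h1 : cornerClass g (4 * k + 1) = cornerClass g (4 * k) := a.2.trans h2
    have h4 : cornerClass g (4 * k + 4) = cornerClass g (4 * k) := b.1.symm.trans h1
    intro r hr
    interval_cases r <;> first | rfl | assumption
  have base : ∀ k ≤ g, cornerClass g (4 * k) = cornerClass g 0 := by
    intro k
    induction k with
    | zero => intro _; rfl
    | succ k ih =>
      intro hk
      exact (block k (by omega) 4 le_rfl).trans (ih (by omega))
  have hmod : cornerClass g i = cornerClass g (i % (4 * g)) := by
    unfold cornerClass
    congr 2
    exact (polygonVertex_mod hg i).symm
  have hlt : i % (4 * g) < 4 * g := Nat.mod_lt _ (by omega)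
  rw [hmod, ← Nat.div_add_mod (i % (4 * g)) 4, block _ (by omega) _ (by omega), base _ (by omega)]

end Polygon

/-! ### A bipartite triangulation of the polygon without interior vertices -/

/-- `IsPolygonFace g a b c χ` says that the triangle with vertices numbered `a < b < c` belongs to
the chosen triangulation of the `4g`-gon, and has colour `χ`. -/
def IsPolygonFace (g a b c : ℕ) (χ : Bool) : Prop :=
  -- The first family carries sides `4k` and `4k + 1`; the second carries `4k + 2`, and its last
  -- member also side `4g - 1`; the third carries the other sides `4k + 3`; the fourth carries none.
  (∃ k, k < g ∧ a = 4 * k ∧ b = 4 * k + 1 ∧ c = 4 * k + 2 ∧ χ = true) ∨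
  (∃ k, k < g ∧ a = 0 ∧ b = 4 * k + 2 ∧ c = 4 * k + 3 ∧ χ = false) ∨
  (∃ k, k + 1 < g ∧ a = 4 * k + 3 ∧ b = 4 * k + 4 ∧ c = 4 * k + 6 ∧ χ = false) ∨
  (∃ k, k + 1 < g ∧ a = 0 ∧ b = 4 * k + 3 ∧ c = 4 * k + 6 ∧ χ = true)

section Combinatorics

variable {g a b c a' b' c' : ℕ} {χ χ' : Bool}

lemma IsPolygonFace.lt (h : IsPolygonFace g a b c χ) : a < b ∧ b < c ∧ c < 4 * g := by
  rcases h with ⟨k, h⟩ | ⟨k, h⟩ | ⟨k, h⟩ | ⟨k, h⟩ <;> omega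

/-- Two triangles are equal, or the second one lies behind an edge of the first one. -/
lemma IsPolygonFace.separated (h : IsPolygonFace g a b c χ) (h' : IsPolygonFace g a' b' c' χ') :
    (a = a' ∧ b = b' ∧ c = c') ∨ (a ≤ a' ∧ c' ≤ b) ∨ (b ≤ a' ∧ c' ≤ c) ∨
      ((a' ≤ a ∨ c ≤ a') ∧ (b' ≤ a ∨ c ≤ b') ∧ (c' ≤ a ∨ c ≤ c')) := by
  rcases h with ⟨k, h⟩ | ⟨k, h⟩ | ⟨k, h⟩ | ⟨k, h⟩ <;>
  rcases h' with ⟨k', h'⟩ | ⟨k', h'⟩ | ⟨k', h'⟩ | ⟨k', h'⟩ <;>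
  obtain ⟨hk, rfl, rfl, rfl, -⟩ := h <;> obtain ⟨hk', rfl, rfl, rfl, -⟩ := h' <;> omega

lemma IsPolygonFace.color_eq (h : IsPolygonFace g a b c χ) (h' : IsPolygonFace g a b c χ') :
    χ = χ' := by
  rcases h with ⟨k, h⟩ | ⟨k, h⟩ | ⟨k, h⟩ | ⟨k, h⟩ <;>
  rcases h' with ⟨k', h'⟩ | ⟨k', h'⟩ | ⟨k', h'⟩ | ⟨k', h'⟩ <;>
  obtain ⟨hk, h1, h2, h3, rfl⟩ := h <;> obtain ⟨hk', h4, h5, h6, rfl⟩ := h' <;>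
  first | rfl | (exfalso; omega)

/-- Different triangles with two common vertices have different colours. -/
lemma IsPolygonFace.color_ne (h : IsPolygonFace g a b c χ) (h' : IsPolygonFace g a' b' c' χ')
    (hne : ¬(a = a' ∧ b = b' ∧ c = c')) {i j : ℕ} (hij : i < j)
    (hi : i = a ∨ i = b ∨ i = c) (hj : j = a ∨ j = b ∨ j = c)
    (hi' : i = a' ∨ i = b' ∨ i = c') (hj' : j = a' ∨ j = b' ∨ j = c') : χ ≠ χ' := by
  rcases h with ⟨k, h⟩ | ⟨k, h⟩ | ⟨k, h⟩ | ⟨k, h⟩ <;>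
  rcases h' with ⟨k', h'⟩ | ⟨k', h'⟩ | ⟨k', h'⟩ | ⟨k', h'⟩ <;>
  obtain ⟨hk, rfl, rfl, rfl, rfl⟩ := h <;> obtain ⟨hk', rfl, rfl, rfl, rfl⟩ := h' <;>
  first | (intro h; exact absurd h (by decide)) | (exfalso; omega)

/-- The colour of the triangle adjacent to a side. -/
lemma IsPolygonFace.color_side (h : IsPolygonFace g a b c χ) {j j' : ℕ}
    (hjj : j' = j + 1 ∨ (j + 1 = 4 * g ∧ j' = 0))
    (hj : j = a ∨ j = b ∨ j = c) (hj' : j' = a ∨ j' = b ∨ j' = c) : χ = decide (j % 4 < 2) := by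
  rcases h with ⟨k, h⟩ | ⟨k, h⟩ | ⟨k, h⟩ | ⟨k, h⟩ <;>
  obtain ⟨hk, rfl, rfl, rfl, rfl⟩ := h <;> rw [eq_comm] <;>
  simp only [decide_eq_true_eq, decide_eq_false_iff_not] <;> omega

end Combinatorics

/-! ### Realizing the triangulation in the polygon surface -/

/-- A point which is not a vertex has two positive barycentric coordinates. -/
lemma exists_two_pos {x : Triangle} (hx : x ∉ vertices) :
    ∃ m n, m ≠ n ∧ 0 < x.1 m ∧ 0 < x.1 n := by
  by_contra! h
  have hs := x.2.2
  obtain ⟨m, -, hm⟩ : ∃ m ∈ Finset.univ, 0 < x.1 m :=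
    Finset.exists_lt_of_sum_lt (f := fun _ => (0 : ℝ)) (by rw [hs]; simp)
  refine hx ⟨m, ?_⟩
  rwa [Finset.sum_eq_single m (fun n _ hn => le_antisymm (h m n hn.symm hm) (x.2.1 n))
    (by simp)] at hs

/-- The faces of the triangulation of the `4g`-gon. -/
abbrev PolygonFace (g : ℕ) : Type :=
  {t : Fin (4 * g) × Fin (4 * g) × Fin (4 * g) × Bool //
    IsPolygonFace g t.1 t.2.1 t.2.2.1 t.2.2.2}

namespace PolygonFace

variable {g : ℕ}

/-- The number of a corner of a face. -/
def corner (f : PolygonFace g) : Fin 3 → ℕ := ![f.1.1, f.1.2.1, f.1.2.2.1]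

/-- The colour of a face. -/
def color (f : PolygonFace g) : Bool := f.1.2.2.2

lemma isPolygonFace (f : PolygonFace g) :
    IsPolygonFace g (f.corner 0) (f.corner 1) (f.corner 2) f.color := f.2

lemma corner_lt (f : PolygonFace g) (m : Fin 3) : f.corner m < 4 * g := by
  fin_cases m
  · exact f.1.1.2
  · exact f.1.2.1.2
  · exact f.1.2.2.1.2

lemma corner_injective (f : PolygonFace g) : Function.Injective f.corner := by
  have := f.isPolygonFace.lt
  intro m n h
  fin_cases m <;> fin_cases n <;> simp at h ⊢ <;> omega

lemma exists_corner_iff (f : PolygonFace g) (i : ℕ) :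
    (∃ m, f.corner m = i) ↔ i = f.corner 0 ∨ i = f.corner 1 ∨ i = f.corner 2 := by
  simp only [Fin.exists_fin_succ, Fin.exists_fin_zero, or_false]
  simp only [eq_comm (a := i)]
  rfl

lemma eq_of_corner {f f' : PolygonFace g} (h0 : f.corner 0 = f'.corner 0)
    (h1 : f.corner 1 = f'.corner 1) (h2 : f.corner 2 = f'.corner 2) : f = f' := by
  have hc : f.color = f'.color := by
    have h := f.isPolygonFace
    rw [h0, h1, h2] at h
    exact h.color_eq f'.isPolygonFace
  exact Subtype.ext (Prod.ext (Fin.ext h0) (Prod.ext (Fin.ext h1) (Prod.ext (Fin.ext h2) hc)))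

/-- The position of a point of a face in the plane. -/
noncomputable def toPlane (f : PolygonFace g) (x : Triangle) : ℂ :=
  ∑ m, x.1 m • polygonVertex g (f.corner m)

lemma toPlane_mem (f : PolygonFace g) (x : Triangle) : f.toPlane x ∈ polygon g :=
  (convex_convexHull ℝ _).sum_mem (fun m _ => x.2.1 m) x.2.2
    fun m _ => polygonVertex_mem g (f.corner m)

/-- The parametrization of a face of the polygon surface. -/
noncomputable def param (f : PolygonFace g) (x : Triangle) : PolygonSurface g :=
  Quot.mk _ ⟨f.toPlane x, f.toPlane_mem x⟩

lemma continuous_param (f : PolygonFace g) : Continuous f.param := by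
  have hc : ∀ i : Fin 3, Continuous fun x : Triangle => x.1 i := fun i =>
    (continuous_apply i).comp continuous_subtype_val
  refine continuous_quot_mk.comp (Continuous.subtype_mk ?_ _)
  exact continuous_finsetSum _ fun m _ => (hc m).smul continuous_const

lemma orient_pos (hg : 0 < g) (f : PolygonFace g) :
    0 < orient (polygonVertex g (f.corner 0)) (polygonVertex g (f.corner 1))
      (polygonVertex g (f.corner 2)) := by
  have := f.isPolygonFace.lt
  exact orient_polygonVertex_pos hg (by omega) (by omega) (by omega)

lemma toPlane_vertex (f : PolygonFace g) (i : Fin 3) :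
    f.toPlane (vertex i) = polygonVertex g (f.corner i) := by
  simp [toPlane, vertex, Pi.single_apply]

/-- Corners of the polygon are extreme points, so a combination with two positive weights at
distinct corners is not one. -/
lemma toPlane_ne (hg : 0 < g) (f : PolygonFace g) {x : Triangle} (hx : x ∉ vertices) (i : ℕ) :
    f.toPlane x ≠ polygonVertex g i := by
  intro h
  obtain ⟨m, n, hmn, hm, hn⟩ := exists_two_pos hx
  have key := fun {m : Fin 3} (hm : 0 < x.1 m) =>
    eq_of_sum_eq_of_norm_eq_one (fun m => norm_polygonVertex g (f.corner m))
      (norm_polygonVertex g i) h hm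
  exact hmn (f.corner_injective (polygonVertex_injective hg (f.corner_lt m) (f.corner_lt n)
    ((key hm).trans (key hn).symm)))

/-- The image of an edge is the open segment between its end points. -/
lemma image_openEdge (f : PolygonFace g) {e m n : Fin 3} (hem : m ≠ e) (hen : n ≠ e)
    (hmn : m ≠ n) : f.toPlane '' openEdge e =
      openSegment ℝ (polygonVertex g (f.corner m)) (polygonVertex g (f.corner n)) := by
  have hsum : ∀ h : Fin 3 → ℂ, ∑ i, h i = h e + h m + h n := by
    intro h
    rw [Fin.sum_univ_three]
    fin_cases e <;> fin_cases m <;> fin_cases n <;> simp at * <;> ring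
  have hsum' : ∀ h : Fin 3 → ℝ, ∑ i, h i = h e + h m + h n := by
    intro h
    rw [Fin.sum_univ_three]
    fin_cases e <;> fin_cases m <;> fin_cases n <;> simp at * <;> ring
  ext z
  constructor
  · rintro ⟨x, ⟨hx0, hx⟩, rfl⟩
    refine ⟨x.1 m, x.1 n, hx m hem, hx n hen, ?_, ?_⟩
    · have := x.2.2
      rw [hsum', hx0] at this
      linarith
    · rw [toPlane, hsum, hx0]
      simp
  · rintro ⟨s, t, hs, ht, hst, rfl⟩
    have hx : ∀ i, i ≠ e → i = m ∨ i = n := by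
      clear hsum hsum'
      revert e m n
      decide
    let y : Fin 3 → ℝ := fun i => if i = m then s else if i = n then t else 0
    have ym : y m = s := by simp [y]
    have yn : y n = t := by simp [y, hmn.symm]
    have ye : y e = 0 := by simp [y, hem.symm, hen.symm]
    refine ⟨⟨y, fun i => ?_, ?_⟩, ⟨ye, fun i hi => ?_⟩, ?_⟩
    · simp only [y]; split_ifs <;> linarith
    · rw [hsum', ye, ym, yn]; linarith
    · rcases hx i hi with rfl | rfl
      · exact hs.trans_eq ym.symm
      · exact ht.trans_eq yn.symm
    · rw [toPlane, hsum]
      simp [ye, ym, yn]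

/-- The image in the surface of the open segment between two vertices. -/
def chord (g i j : ℕ) : Set (PolygonSurface g) :=
  {p | ∃ z : polygon g, (z : ℂ) ∈ openSegment ℝ (polygonVertex g i) (polygonVertex g j) ∧
    Quot.mk _ z = p}

lemma chord_symm (g i j : ℕ) : chord g i j = chord g j i := by
  unfold chord; rw [openSegment_symm]

/-- A point supported on two corners lies on the edge joining them. -/
lemma mem_openEdge_of_support (f : PolygonFace g) {x : Triangle} (hx : x ∉ vertices) {i j : ℕ}
    (h : ∀ m, 0 < x.1 m → f.corner m = i ∨ f.corner m = j) :
    (∃ m, f.corner m = i) ∧ (∃ m, f.corner m = j) ∧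
      ∃ e, x ∈ openEdge e ∧ f.param '' openEdge e = chord g i j := by
  obtain ⟨m, n, hmn, hm, hn⟩ := exists_two_pos hx
  have hmn' : f.corner m ≠ f.corner n := fun h => hmn (f.corner_injective h)
  obtain ⟨e, hem, hen⟩ : ∃ e, m ≠ e ∧ n ≠ e := by
    clear hm hn hmn'
    revert m n
    decide
  have he : x.1 e = 0 := by
    by_contra hne
    have hpos := lt_of_le_of_ne (x.2.1 e) (Ne.symm hne)
    have h1 : f.corner m ≠ f.corner e := fun h => hem (f.corner_injective h)
    have h2 : f.corner n ≠ f.corner e := fun h => hen (f.corner_injective h)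
    have := h m hm; have := h n hn; have := h e hpos
    omega
  have himg : f.param '' openEdge e = chord g (f.corner m) (f.corner n) := by
    have := f.image_openEdge hem hen hmn
    ext p
    constructor
    · rintro ⟨y, hy, rfl⟩
      exact ⟨⟨f.toPlane y, f.toPlane_mem y⟩, this ▸ Set.mem_image_of_mem _ hy, rfl⟩
    · rintro ⟨⟨z, hz⟩, hz', rfl⟩
      rw [← this] at hz'
      obtain ⟨y, hy, rfl⟩ := hz'
      exact ⟨y, hy, rfl⟩
  have hxe := mem_openEdge_of_eq_zero hx he
  rcases h m hm with h1 | h1 <;> rcases h n hn with h2 | h2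
  · exact absurd (h1.trans h2.symm) hmn'
  · exact ⟨⟨m, h1⟩, ⟨n, h2⟩, e, hxe, by rw [himg, h1, h2]⟩
  · exact ⟨⟨n, h2⟩, ⟨m, h1⟩, e, hxe, by rw [himg, h1, h2, chord_symm]⟩
  · exact absurd (h1.trans h2.symm) hmn'

/-- A common point of two faces on different sides of a chord lies on that chord. -/
lemma support_of_separated (hg : 0 < g) {f f' : PolygonFace g} {x y : Triangle}
    (hxy : f.toPlane x = f'.toPlane y) {i j : ℕ} (hij : i < j) (hj : j < 4 * g)
    (hf : ∀ m, f.corner m ≤ i ∨ j ≤ f.corner m) (hf' : ∀ m, i ≤ f'.corner m ∧ f'.corner m ≤ j) :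
    (∀ m, 0 < x.1 m → f.corner m = i ∨ f.corner m = j) ∧
      ∀ m, 0 < y.1 m → f'.corner m = i ∨ f'.corner m = j := by
  set c : ℕ → ℝ := fun k => orient (polygonVertex g i) (polygonVertex g j) (polygonVertex g k)
    with hc
  have hsum : ∑ m, x.1 m * c (f.corner m) = ∑ m, y.1 m * c (f'.corner m) := by
    rw [← orient_sum, ← orient_sum]
    exact congrArg _ hxy
  have hci : c i = 0 := orient_left _ _
  have hcj : c j = 0 := orient_right _ _
  have h1 : ∀ m, 0 ≤ c (f.corner m) ∧ (c (f.corner m) = 0 → f.corner m = i ∨ f.corner m = j) := by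
    intro m
    by_cases e1 : f.corner m = i
    · rw [e1, hci]; simp
    by_cases e2 : f.corner m = j
    · rw [e2, hcj]; simp
    have := hf m
    have := (orient_chord hg hij hj (f.corner_lt m)).2 (by omega)
    exact ⟨this.le, fun h => absurd h this.ne'⟩
  have h2 : ∀ m, c (f'.corner m) ≤ 0 ∧
      (c (f'.corner m) = 0 → f'.corner m = i ∨ f'.corner m = j) := by
    intro m
    by_cases e1 : f'.corner m = i
    · rw [e1, hci]; simp
    by_cases e2 : f'.corner m = j
    · rw [e2, hcj]; simp
    have := hf' m
    have := (orient_chord hg hij hj (f'.corner_lt m)).1 (by omega)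
    exact ⟨this.le, fun h => absurd h this.ne⟩
  have p1 : ∀ m ∈ Finset.univ, 0 ≤ x.1 m * c (f.corner m) :=
    fun m _ => mul_nonneg (x.2.1 m) (h1 m).1
  have p2 : ∀ m ∈ Finset.univ, y.1 m * c (f'.corner m) ≤ 0 :=
    fun m _ => mul_nonpos_of_nonneg_of_nonpos (y.2.1 m) (h2 m).1
  -- A sum of nonnegative terms equals a sum of nonpositive ones, so every term of both vanishes.
  have s1 : ∑ m, x.1 m * c (f.corner m) = 0 :=
    le_antisymm (hsum ▸ Finset.sum_nonpos p2) (Finset.sum_nonneg p1)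
  have s2 : ∑ m, y.1 m * c (f'.corner m) = 0 := hsum ▸ s1
  rw [Finset.sum_eq_zero_iff_of_nonneg p1] at s1
  rw [Finset.sum_eq_zero_iff_of_nonpos p2] at s2
  exact ⟨fun m hm => (h1 m).2 ((mul_eq_zero.1 (s1 m (Finset.mem_univ m))).resolve_left hm.ne'),
    fun m hm => (h2 m).2 ((mul_eq_zero.1 (s2 m (Finset.mem_univ m))).resolve_left hm.ne')⟩

/-- Faces meet in the plane along whole edges which separate different colours. -/
lemma toPlane_eq (hg : 0 < g) {f f' : PolygonFace g} {x y : Triangle} (hx : x ∉ vertices)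
    (hy : y ∉ vertices) (hxy : f.toPlane x = f'.toPlane y) :
    (f = f' ∧ x = y) ∨ (f.color ≠ f'.color ∧ ∃ e e', x ∈ openEdge e ∧ y ∈ openEdge e' ∧
      f.param '' openEdge e = f'.param '' openEdge e') := by
  by_cases hne : f.corner 0 = f'.corner 0 ∧ f.corner 1 = f'.corner 1 ∧ f.corner 2 = f'.corner 2
  · obtain rfl := eq_of_corner hne.1 hne.2.1 hne.2.2
    exact Or.inl ⟨rfl, barycentric_injective (f.orient_pos hg) hxy⟩
  right
  have lt := f.isPolygonFace.lt
  have lt' := f'.isPolygonFace.lt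
  obtain ⟨i, j, hij, hs⟩ : ∃ i j, i < j ∧
      ((∀ m, 0 < x.1 m → f.corner m = i ∨ f.corner m = j) ∧
        ∀ m, 0 < y.1 m → f'.corner m = i ∨ f'.corner m = j) := by
    rcases f.isPolygonFace.separated f'.isPolygonFace with h | h | h | h
    · exact absurd h hne
    · refine ⟨f.corner 0, f.corner 1, lt.1, support_of_separated hg hxy lt.1 (by omega) ?_ ?_⟩ <;>
        intro m <;> fin_cases m <;> simp <;> omega
    · refine ⟨f.corner 1, f.corner 2, lt.2.1, support_of_separated hg hxy lt.2.1 lt.2.2 ?_ ?_⟩ <;>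
        intro m <;> fin_cases m <;> simp <;> omega
    -- Here `f` lies in the arc cut off by its own longest chord and `f'` lies beyond it, so the
    -- roles are exchanged.
    · refine ⟨f.corner 0, f.corner 2, by omega,
        (support_of_separated hg hxy.symm (by omega) lt.2.2 ?_ ?_).symm⟩ <;>
        intro m <;> fin_cases m <;> simp <;> omega
  obtain ⟨ci, cj, e, he, hi⟩ := f.mem_openEdge_of_support hx hs.1
  obtain ⟨ci', cj', e', he', hi'⟩ := f'.mem_openEdge_of_support hy hs.2
  rw [exists_corner_iff] at ci cj ci' cj'
  exact ⟨f.isPolygonFace.color_ne f'.isPolygonFace hne hij ci cj ci' cj',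
    e, e', he, he', hi.trans hi'.symm⟩

lemma chord_side_subset {j : ℕ} (hj : j < 4 * g) :
    chord g j (j + 1) ⊆ chord g (partner j) (partner j + 1) := by
  rintro _ ⟨⟨z, hz⟩, hz', rfl⟩
  rw [openSegment_eq_image_lineMap] at hz'
  obtain ⟨t, ht, rfl⟩ := hz'
  refine ⟨⟨sidePoint g (partner j) (1 - t),
    sidePoint_mem _ _ (Set.Ioo_subset_Icc_self (one_sub_mem ht))⟩, ?_, ?_⟩
  · rw [openSegment_eq_image_lineMap]
    exact ⟨1 - t, one_sub_mem ht, rfl⟩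
  · exact (mk_sidePoint hj (Set.Ioo_subset_Icc_self ht) rfl rfl).symm

lemma chord_side {j : ℕ} (hj : j < 4 * g) :
    chord g j (j + 1) = chord g (partner j) (partner j + 1) := by
  refine (chord_side_subset hj).antisymm ?_
  have := chord_side_subset (partner_lt hj)
  rwa [partner_partner] at this

/-- A point of a face on a side of the polygon lies on an edge of the face. -/
lemma toPlane_eq_sidePoint (hg : 0 < g) (f : PolygonFace g) {x : Triangle} (hx : x ∉ vertices)
    {j : ℕ} (hj : j < 4 * g) {t : ℝ} (h : f.toPlane x = sidePoint g j t) :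
    f.color = decide (j % 4 < 2) ∧ ∃ e, x ∈ openEdge e ∧
      f.param '' openEdge e = chord g j (j + 1) := by
  set c : ℕ → ℝ := fun k =>
    orient (polygonVertex g j) (polygonVertex g (j + 1)) (polygonVertex g k) with hc
  have hsum : ∑ m, x.1 m * c (f.corner m) = 0 := by
    rw [← orient_sum]
    change orient _ _ (f.toPlane x) = 0
    rw [h, sidePoint_eq]
    simp [orient]
    ring
  rw [Finset.sum_eq_zero_iff_of_nonneg fun m _ =>
    mul_nonneg (x.2.1 m) (orient_side hg j (f.corner m)).1] at hsum
  have hlt : (j + 1) % (4 * g) < 4 * g := Nat.mod_lt _ (by omega)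
  -- The end index is reduced modulo `4 * g` because the last side ends at vertex 0.
  have hs : ∀ m, 0 < x.1 m → f.corner m = j ∨ f.corner m = (j + 1) % (4 * g) := by
    intro m hm
    have h0 := (mul_eq_zero.1 (hsum m (Finset.mem_univ m))).resolve_left hm.ne'
    rcases (orient_side hg j (f.corner m)).2 h0 with h | h
    · exact Or.inl (polygonVertex_injective hg (f.corner_lt m) hj h)
    · rw [← polygonVertex_mod hg (j + 1)] at h
      exact Or.inr (polygonVertex_injective hg (f.corner_lt m) hlt h)
  obtain ⟨ci, cj, e, he, hi⟩ := f.mem_openEdge_of_support hx hs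
  rw [exists_corner_iff] at ci cj
  refine ⟨f.isPolygonFace.color_side ?_ ci cj, e, he, ?_⟩
  · rcases Nat.lt_or_ge (j + 1) (4 * g) with h | h
    · exact Or.inl (Nat.mod_eq_of_lt h)
    · have : j + 1 = 4 * g := by omega
      exact Or.inr ⟨this, by rw [this, Nat.mod_self]⟩
  · rw [hi]
    unfold chord
    rw [polygonVertex_mod hg]

lemma exists_toPlane_of_orient (hg : 0 < g) {a b c : ℕ} {χ : Bool} (h : IsPolygonFace g a b c χ)
    {z : ℂ} (h01 : 0 ≤ orient (polygonVertex g a) (polygonVertex g b) z)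
    (h12 : 0 ≤ orient (polygonVertex g b) (polygonVertex g c) z)
    (h02 : orient (polygonVertex g a) (polygonVertex g c) z ≤ 0) :
    ∃ f : PolygonFace g, ∃ x, f.toPlane x = z := by
  have lt := h.lt
  let f : PolygonFace g :=
    ⟨(⟨a, by omega⟩, ⟨b, by omega⟩, ⟨c, by omega⟩, χ), h⟩
  obtain ⟨x, hx⟩ := exists_barycentric (w := fun m => polygonVertex g (f.corner m))
    (f.orient_pos hg) h01 h12 h02
  exact ⟨f, x, hx⟩

/-- The faces cover the polygon. -/
lemma exists_toPlane_eq (hg : 0 < g) {z : ℂ} (hz : z ∈ polygon g) :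
    ∃ f : PolygonFace g, ∃ x, f.toPlane x = z := by
  have side := fun j => orient_side_nonneg hg j hz
  set o : ℕ → ℕ → ℝ := fun i j => orient (polygonVertex g i) (polygonVertex g j) z with ho
  by_contra hcon
  -- A point in no face that is inside the edges `a b` and `b c` must lie strictly beyond `a c`.
  -- This sweeps the point across one triangle after another.
  have face : ∀ {a b c : ℕ} {χ : Bool}, IsPolygonFace g a b c χ → 0 ≤ o a b → 0 ≤ o b c →
      0 < o a c := by
    intro a b c χ h h01 h12
    by_contra h02
    exact hcon (exists_toPlane_of_orient hg h h01 h12 (not_lt.1 h02))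
  have key : ∀ k < g, 0 < o 0 (4 * k + 3) := by
    intro k
    induction k with
    | zero =>
      intro hk
      have h2 : 0 < o 0 2 := face (Or.inl ⟨0, hk, rfl, rfl, rfl, rfl⟩) (side 0) (side 1)
      exact face (Or.inr (Or.inl ⟨0, hk, rfl, rfl, rfl, rfl⟩)) h2.le (side 2)
    | succ k ih =>
      intro hk
      have h3 := ih (by omega)
      have h46 : 0 < o (4 * k + 4) (4 * k + 6) :=
        face (Or.inl ⟨k + 1, hk, by ring, rfl, rfl, rfl⟩) (side _) (side _)
      have h36 : 0 < o (4 * k + 3) (4 * k + 6) :=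
        face (Or.inr (Or.inr (Or.inl ⟨k, hk, rfl, rfl, rfl, rfl⟩))) (side _) h46.le
      have h6 : 0 < o 0 (4 * k + 6) :=
        face (Or.inr (Or.inr (Or.inr ⟨k, hk, rfl, rfl, rfl, rfl⟩))) h3.le h36.le
      exact face (Or.inr (Or.inl ⟨k + 1, hk, rfl, by ring, by ring, rfl⟩)) h6.le (side _)
  have h1 := key (g - 1) (by omega)
  have h2 := side (4 * (g - 1) + 3)
  -- The last chord reached is side `4 * g - 1` traversed backwards, so the point would be outside
  -- the polygon.
  have e : polygonVertex g (4 * (g - 1) + 3 + 1) = polygonVertex g 0 := by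
    rw [show 4 * (g - 1) + 3 + 1 = 0 + 4 * g by omega, polygonVertex_add hg]
  rw [e, orient_swap_left] at h2
  change 0 ≤ -o 0 (4 * (g - 1) + 3) at h2
  linarith

/-- The triangulation of the polygon surface with a single vertex. -/
noncomputable def triangulation (hg : 0 < g) :
    ColoredTriangulation (PolygonSurface g) {cornerClass g 0} where
  Face := PolygonFace g
  finite_face := inferInstance
  nonempty_face := ⟨(exists_toPlane_eq hg (polygonVertex_mem g 0)).choose⟩
  param := param
  color := color
  continuous_param := continuous_param
  param_mem_iff f x := by
    rw [Set.mem_singleton_iff]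
    constructor
    · intro h
      by_contra hx
      rcases sideRel_of_mk_eq hg h with h | ⟨⟨i, hi⟩, -⟩ | ⟨j, -, t, ht, -, h⟩
      · exact f.toPlane_ne hg hx 0 (congrArg Subtype.val h)
      · exact f.toPlane_ne hg hx i hi
      · exact sidePoint_ne_polygonVertex hg _ _ (one_sub_mem ht) h.symm
    · intro hx
      obtain ⟨i, rfl⟩ := (mem_vertices_iff_exists x).1 hx
      rw [← cornerClass_eq g (f.corner i) hg]
      simp only [param, cornerClass, toPlane_vertex]
  exists_param_eq p _ := by
    obtain ⟨⟨z, hz⟩, rfl⟩ := Quot.exists_rep p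
    obtain ⟨f, x, rfl⟩ := exists_toPlane_eq hg hz
    exact ⟨f, x, rfl⟩
  eq_or_edge f f' x y hx hy h := by
    rcases sideRel_of_mk_eq hg h with h | ⟨⟨i, hi⟩, -⟩ | ⟨j, hj, t, ht, h1, h2⟩
    · exact toPlane_eq hg hx hy (congrArg Subtype.val h)
    · exact absurd hi (f.toPlane_ne hg hx i)
    · obtain ⟨c, e, he, hi⟩ := f.toPlane_eq_sidePoint hg hx hj h1
      obtain ⟨c', e', he', hi'⟩ := f'.toPlane_eq_sidePoint hg hy (partner_lt hj) h2
      refine Or.inr ⟨?_, e, e', he, he', by rw [hi, hi', chord_side hj]⟩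
      rw [c, c']
      unfold partner
      split_ifs with h4 <;> simp <;> omega

end PolygonFace

/-! ### The main theorem -/

lemma exists_triangulation {g n : ℕ} (hn : 0 < n) (hχ : 2 - 2 * (g : ℤ) - (n : ℤ) < 0)
    {S : Type*} [TopologicalSpace S] (hS : HasGenus S g) :
    ∃ P : Finset S, P.card = n ∧ Nonempty (ColoredTriangulation S (P : Set S)) := by
  classical
  have transport : ∀ {S' : Type} [TopologicalSpace S'], S ≃ₜ S' →
      (∃ P : Finset S', P.card = n ∧ Nonempty (ColoredTriangulation S' (P : Set S'))) →
      ∃ P : Finset S, P.card = n ∧ Nonempty (ColoredTriangulation S (P : Set S)) := by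
    rintro S' _ e ⟨P, hP, ⟨T⟩⟩
    refine ⟨P.image e.symm, ?_, ⟨?_⟩⟩
    · rw [Finset.card_image_of_injective _ e.symm.injective, hP]
    · rw [Finset.coe_image]
      exact T.map e.symm
  cases g with
  | zero =>
    obtain ⟨e⟩ := hS
    obtain ⟨P, hP, ⟨T⟩⟩ := exists_sphere_triangulation
    -- For genus zero the Euler characteristic condition is exactly `3 ≤ n`, the size of the
    -- starting example.
    exact transport e (ColoredTriangulation.exists_card (by push_cast at hχ; omega) P hP T)
  | succ g =>
    obtain ⟨e⟩ := hS
    refine transport e (ColoredTriangulation.exists_card hn {cornerClass (g + 1) 0}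
      (Finset.card_singleton _) ?_)
    rw [Finset.coe_singleton]
    exact PolygonFace.triangulation (Nat.succ_pos g)

end PuncturedSurface

theorem mainTheorem6 (g n : ℕ) (hn : 0 < n) (hχ : 2 - 2 * (g : ℤ) - (n : ℤ) < 0)
    (S : Type*) [TopologicalSpace S] [T2Space S] [CompactSpace S] [ConnectedSpace S]
    [ChartedSpace (EuclideanSpace ℝ (Fin 2)) S] (hS : PuncturedSurface.HasGenus S g)
    (P : Finset S) (hP : P.card = n) :
    ∃ T : PuncturedSurface.IdealTriangulation S (P : Set S), T.IsBipartite := by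
  obtain ⟨Q, hQ, ⟨T⟩⟩ := PuncturedSurface.exists_triangulation hn hχ hS
  obtain ⟨H, hH⟩ := PuncturedSurface.exists_homeomorph_image_eq (EuclideanSpace ℝ (Fin 2))
    (by rw [← Module.finrank_eq_rank, finrank_euclideanSpace_fin]; norm_num)
    (hQ.trans hP.symm)
  have T' := T.map H
  rw [hH] at T'
  exact ⟨T'.toIdealTriangulation, T'.isBipartite⟩
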